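/- Let $G$ be a locally compact (Hausdorff) group with identity $e$ and a fixed left Haar measure $dx$, let $1<p<\infty$ and $\frac1p+\frac1q=1$. Let $A_p(G)$ be the Herz algebra: the space of all functions $u(x)=\sum_{i\ge1}(g_i*f_i^{\vee})(x)$ on $G$ with $f_i\in L^p(G)$, $g_i\in L^q(G)$, $\sum_i\|f_i\|_p\|g_i\|_q<\infty$, where $f^\vee(x)=f(x^{-1})$, $(g*h)(x)=\int_G g(y)h(y^{-1}x)\,dy$, with norm $\|u\|_{A_p(G)}=\inf\sum_i\|f_i\|_p\|g_i\|_q$ over all such representations of $u$. Let $B_p(G)$ be the algebra (under pointwise operations) of all bounded continuous functions $u:G\to\mathbb C$ such that $uv\in A_p(G)$ for all $v\in A_p(G)$, with the norm $\|u\|=\sup\{\|uv\|_{A_p(G)}:\|v\|_{A_p(G)}\le1\}$. For $T\in B_p(G)^*$ and $u\in B_p(G)$ let $uT\in B_p(G)^*$ be given by $\langle uT,v\rangle=\langle T,uv\rangle$, and let $I\in B_p(G)^*$ be $I(u)=u(e)$. A functional $T\in B_p(G)^*$ is weakly almost periodic if $\{uT:u\in B_p(G),\ \|u\|\le1\}$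 is relatively compact in the weak topology of the Banach space $B_p(G)^*$; let $wap(B_p(G))$ be the subspace of $B_p(G)^*$, with the dual norm, of all such $T$. It contains $I$ and is closed under $T\mapsto uT$ for every $u\in B_p(G)$. Then there is a unique topological invariant mean on $wap(B_p(G))$, that is, exactly one $F\in wap(B_p(G))^*$ with $\|F\|=F(I)=1$ and $$F(uT)=u(e)F(T)\qquad\text{for all }u\in B_p(G),\ T\in wap(B_p(G)).\tag{1}$$ In fact there is exactly one $F\in wap(B_p(G))^*$ with $F(I)=1$ and (1). -/

import Mathlib

open MeasureTheory Filter Topology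
open scoped ENNReal BoundedContinuousFunction

noncomputable section

namespace Herz

section Representations

variable {G : Type*} [Group G] [MeasurableSpace G]

/-- Convolution `(g * h)(x) = ∫ g(y) h(y⁻¹ x) dy` with respect to the left Haar measure `μ`. -/
def conv (μ : Measure G) (g h : G → ℂ) (x : G) : ℂ :=
  ∫ y, g y * h (y⁻¹ * x) ∂μ

/-- `f^∨(x) = f(x⁻¹)`. -/
def check (f : G → ℂ) (x : G) : ℂ :=
  f x⁻¹

/-- `u(x) = ∑ᵢ (gᵢ * fᵢ^∨)(x)` for all `x`, where `fᵢ ∈ L^p`, `gᵢ ∈ L^q`, `1/p + 1/q = 1`,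
and `∑ᵢ ‖fᵢ‖_p ‖gᵢ‖_q < ∞`. -/
structure IsHerzRep (μ : Measure G) (p : ℝ≥0∞) (u : G → ℂ) (f g : ℕ → G → ℂ) : Prop where
  memLp_left : ∀ i, MemLp (f i) p μ
  memLp_right : ∀ i, MemLp (g i) p.conjExponent μ
  cost_lt_top : ∑' i, eLpNorm (f i) p μ * eLpNorm (g i) p.conjExponent μ < ∞
  hasSum : ∀ x, HasSum (fun i => conv μ (g i) (check (f i)) x) (u x)

/-- The infimum of `∑ᵢ ‖fᵢ‖_p ‖gᵢ‖_q` over all representations `u = ∑ᵢ gᵢ * fᵢ^∨`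
(it is `∞` if there is none). -/
def herzENorm (μ : Measure G) (p : ℝ≥0∞) (u : G → ℂ) : ℝ≥0∞ :=
  ⨅ (f : ℕ → G → ℂ) (g : ℕ → G → ℂ) (_ : IsHerzRep μ p u f g),
    ∑' i, eLpNorm (f i) p μ * eLpNorm (g i) p.conjExponent μ

theorem herzENorm_lt_iff {μ : Measure G} {p : ℝ≥0∞} {u : G → ℂ} {c : ℝ≥0∞} :
    herzENorm μ p u < c ↔ ∃ f g, IsHerzRep μ p u f g ∧
      ∑' i, eLpNorm (f i) p μ * eLpNorm (g i) p.conjExponent μ < c := by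
  simp only [herzENorm, iInf_lt_iff, exists_prop]

theorem herzENorm_le {μ : Measure G} {p : ℝ≥0∞} {u : G → ℂ} {f g : ℕ → G → ℂ}
    (h : IsHerzRep μ p u f g) :
    herzENorm μ p u ≤ ∑' i, eLpNorm (f i) p μ * eLpNorm (g i) p.conjExponent μ :=
  iInf_le_of_le f (iInf_le_of_le g (iInf_le_of_le h le_rfl))

theorem herzENorm_lt_top_iff {μ : Measure G} {p : ℝ≥0∞} {u : G → ℂ} :
    herzENorm μ p u < ∞ ↔ ∃ f g, IsHerzRep μ p u f g := by
  rw [herzENorm_lt_iff]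
  exact ⟨fun ⟨f, g, h, _⟩ => ⟨f, g, h⟩, fun ⟨f, g, h⟩ => ⟨f, g, h, h.cost_lt_top⟩⟩

theorem herzENorm_zero (μ : Measure G) (p : ℝ≥0∞) : herzENorm μ p 0 = 0 := by
  have h : IsHerzRep μ p (0 : G → ℂ) (fun _ => 0) (fun _ => 0) :=
    ⟨fun _ => MemLp.zero, fun _ => MemLp.zero, by simp, fun x => by
      simp [conv, check]⟩
  simpa using herzENorm_le h

theorem herzENorm_smul_le (μ : Measure G) (p : ℝ≥0∞) (c : ℂ) (u : G → ℂ) :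
    herzENorm μ p (c • u) ≤ ‖c‖ₑ * herzENorm μ p u := by
  rcases eq_or_ne c 0 with rfl | hc
  · simp [herzENorm_zero]
  have hc' : ‖c‖ₑ ≠ 0 := by simpa using hc
  have key : ∀ f g, IsHerzRep μ p u f g → herzENorm μ p (c • u) ≤
      ‖c‖ₑ * ∑' i, eLpNorm (f i) p μ * eLpNorm (g i) p.conjExponent μ := by
    intro f g h
    have hcost : ∑' i, eLpNorm (c • f i) p μ * eLpNorm (g i) p.conjExponent μ =
        ‖c‖ₑ * ∑' i, eLpNorm (f i) p μ * eLpNorm (g i) p.conjExponent μ := by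
      rw [← ENNReal.tsum_mul_left]
      exact tsum_congr fun i => by rw [eLpNorm_const_smul, mul_assoc]
    have h' : IsHerzRep μ p (c • u) (fun i => c • f i) g := by
      refine ⟨fun i => (h.memLp_left i).const_smul c, h.memLp_right, ?_, fun x => ?_⟩
      · rw [hcost]; exact ENNReal.mul_lt_top (by simp) h.cost_lt_top
      · refine ((h.hasSum x).mul_left c).congr_fun fun i => ?_
        simp only [conv, check, Pi.smul_apply, smul_eq_mul, ← integral_const_mul]
        exact integral_congr_ae (.of_forall fun y => by ring)
    exact (herzENorm_le h').trans hcost.le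
  rw [mul_comm, ← ENNReal.div_le_iff_le_mul (.inl hc') (.inl (by simp))]
  refine le_iInf fun f => le_iInf fun g => le_iInf fun h => ?_
  rw [ENNReal.div_le_iff_le_mul (.inl hc') (.inl (by simp)), mul_comm]
  exact key f g h

end Representations

section Norm

variable {G : Type*} [Group G] [TopologicalSpace G] [IsTopologicalGroup G]
  [MeasurableSpace G] [BorelSpace G]

theorem enorm_conv_check_le {μ : Measure G} [μ.IsHaarMeasure] {p : ℝ≥0∞} [Fact (1 ≤ p)]
    {f g : G → ℂ} (hf : MemLp f p μ) (hg : MemLp g p.conjExponent μ) (x : G) :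
    ‖conv μ g (check f) x‖ₑ ≤ eLpNorm f p μ * eLpNorm g p.conjExponent μ := by
  have hmp : MeasurePreserving (fun y => x⁻¹ * y) μ μ := measurePreserving_mul_left μ x⁻¹
  have h1 : conv μ g (check f) x = ∫ y, ((f ∘ fun y => x⁻¹ * y) • g) y ∂μ := by
    simp [conv, check, mul_comm]
  rw [h1]
  calc _ ≤ ∫⁻ y, ‖((f ∘ fun y => x⁻¹ * y) • g) y‖ₑ ∂μ := enorm_integral_le_lintegral_enorm _
    _ = eLpNorm ((f ∘ fun y => x⁻¹ * y) • g) 1 μ := eLpNorm_one_eq_lintegral_enorm.symm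
    _ ≤ eLpNorm (f ∘ fun y => x⁻¹ * y) p μ * eLpNorm g p.conjExponent μ :=
      eLpNorm_smul_le_mul_eLpNorm hg.1 (hf.1.comp_measurePreserving hmp)
    _ = _ := by rw [eLpNorm_comp_measurePreserving hf.1 hmp]

theorem enorm_apply_le_herzENorm (μ : Measure G) [μ.IsHaarMeasure] (p : ℝ≥0∞)
    [Fact (1 ≤ p)] (u : G → ℂ) (x : G) : ‖u x‖ₑ ≤ herzENorm μ p u := by
  refine le_iInf fun f => le_iInf fun g => le_iInf fun h => ?_
  rw [← (h.hasSum x).tsum_eq]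
  exact enorm_tsum_le_tsum_enorm.trans (ENNReal.tsum_le_tsum fun i =>
    enorm_conv_check_le (h.memLp_left i) (h.memLp_right i) x)

theorem herzENorm_le_tsum (μ : Measure G) [μ.IsHaarMeasure] (p : ℝ≥0∞) [Fact (1 ≤ p)]
    (u : ℕ → G → ℂ) (U : G → ℂ) (hU : ∀ x, HasSum (fun n => u n x) (U x)) :
    herzENorm μ p U ≤ ∑' n, herzENorm μ p (u n) := by
  refine ENNReal.le_of_forall_pos_le_add fun ε hε hfin => ?_
  obtain ⟨δ, hδ, hδε⟩ := ENNReal.exists_pos_sum_of_countable (ε := ε) (by simpa using hε.ne') ℕ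
  have hn : ∀ n, herzENorm μ p (u n) < herzENorm μ p (u n) + δ n := fun n =>
    ENNReal.lt_add_right (ENNReal.ne_top_of_tsum_ne_top hfin.ne n) (by simpa using (hδ n).ne')
  choose f g hrep hcost using fun n => herzENorm_lt_iff.1 (hn n)
  let F : ℕ → G → ℂ := fun k => f k.unpair.1 k.unpair.2
  let K : ℕ → G → ℂ := fun k => g k.unpair.1 k.unpair.2
  have hsum : ∑' k, eLpNorm (F k) p μ * eLpNorm (K k) p.conjExponent μ ≤
      (∑' n, herzENorm μ p (u n)) + ε := by
    have e1 : ∑' k, eLpNorm (F k) p μ * eLpNorm (K k) p.conjExponent μ =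
        ∑' c : ℕ × ℕ, eLpNorm (f c.1 c.2) p μ * eLpNorm (g c.1 c.2) p.conjExponent μ :=
      Nat.pairEquiv.symm.tsum_eq (fun c : ℕ × ℕ =>
        eLpNorm (f c.1 c.2) p μ * eLpNorm (g c.1 c.2) p.conjExponent μ)
    rw [e1, ENNReal.tsum_prod']
    calc _ ≤ ∑' n, (herzENorm μ p (u n) + δ n) := ENNReal.tsum_le_tsum fun n => (hcost n).le
      _ = (∑' n, herzENorm μ p (u n)) + ∑' n, (δ n : ℝ≥0∞) := ENNReal.tsum_add
      _ ≤ _ := by gcongr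
  have hlt : ∑' k, eLpNorm (F k) p μ * eLpNorm (K k) p.conjExponent μ < ∞ :=
    hsum.trans_lt (ENNReal.add_lt_top.2 ⟨hfin, by simp⟩)
  have hR : IsHerzRep μ p U F K := by
    refine ⟨fun k => (hrep _).memLp_left _, fun k => (hrep _).memLp_right _, hlt, fun x => ?_⟩
    let a : ℕ × ℕ → ℂ := fun c => conv μ (g c.1 c.2) (check (f c.1 c.2)) x
    have hs : Summable (fun k => conv μ (K k) (check (F k)) x) := by
      refine Summable.of_enorm (lt_of_le_of_lt (ENNReal.tsum_le_tsum fun k => ?_) hlt).ne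
      exact enorm_conv_check_le ((hrep _).memLp_left _) ((hrep _).memLp_right _) x
    have hs' : Summable a := by
      rw [← Nat.pairEquiv.symm.summable_iff]; exact hs
    have h2 : HasSum (fun n => u n x) (∑' c, a c) :=
      hs'.hasSum.prod_fiberwise fun n => (hrep n).hasSum x
    rw [(hU x).unique h2]
    exact (Nat.pairEquiv.symm.hasSum_iff (f := a)).2 hs'.hasSum
  exact (herzENorm_le hR).trans hsum

theorem herzENorm_add_le (μ : Measure G) [μ.IsHaarMeasure] (p : ℝ≥0∞) [Fact (1 ≤ p)]
    (u v : G → ℂ) : herzENorm μ p (u + v) ≤ herzENorm μ p u + herzENorm μ p v := by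
  let w : ℕ → G → ℂ := fun n => if n = 0 then u else if n = 1 then v else 0
  have hw : ∀ n ∉ Finset.range 2, w n = 0 := fun n hn => by
    have : n ≠ 0 ∧ n ≠ 1 := by simp at hn; omega
    simp [w, this.1, this.2]
  have h := herzENorm_le_tsum μ p w (u + v) fun x => by
    have := hasSum_sum_of_ne_finset_zero (f := fun n => w n x) (s := Finset.range 2)
      (L := .unconditional ℕ) fun n hn => by simp [hw n hn]
    simpa [Finset.sum_range_succ, w] using this
  rw [tsum_eq_sum (s := Finset.range 2) fun n hn => by rw [hw n hn, herzENorm_zero]] at h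
  simpa [Finset.sum_range_succ, w] using h

/-- The Herz algebra `A_p(G)` as a linear space of functions on `G`. For `1 < p < ∞` its elements
are automatically continuous and vanish at infinity. -/
def herzSubmodule (μ : Measure G) [μ.IsHaarMeasure] (p : ℝ≥0∞) [Fact (1 ≤ p)] :
    Submodule ℂ (G → ℂ) where
  carrier := {u | ∃ f g, IsHerzRep μ p u f g}
  zero_mem' := by
    refine herzENorm_lt_top_iff.1 ?_
    simp [herzENorm_zero]
  add_mem' := by
    intro u v hu hv
    exact herzENorm_lt_top_iff.1 ((herzENorm_add_le μ p u v).trans_lt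
      (ENNReal.add_lt_top.2 ⟨herzENorm_lt_top_iff.2 hu, herzENorm_lt_top_iff.2 hv⟩))
  smul_mem' := by
    intro c u hu
    exact herzENorm_lt_top_iff.1 ((herzENorm_smul_le μ p c u).trans_lt
      (ENNReal.mul_lt_top (by simp) (herzENorm_lt_top_iff.2 hu)))

/-- The Herz algebra `A_p(G)` (as a normed space). -/
def Ap (μ : Measure G) [μ.IsHaarMeasure] (p : ℝ≥0∞) [Fact (1 ≤ p)] : Type _ :=
  herzSubmodule μ p

namespace Ap

variable {μ : Measure G} [μ.IsHaarMeasure] {p : ℝ≥0∞} [Fact (1 ≤ p)]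

instance : AddCommGroup (Ap μ p) := inferInstanceAs (AddCommGroup (herzSubmodule μ p))

instance : Module ℂ (Ap μ p) := inferInstanceAs (Module ℂ (herzSubmodule μ p))

/-- The inclusion of `A_p(G)` into the functions on `G`. -/
def toFun : Ap μ p →ₗ[ℂ] (G → ℂ) := (herzSubmodule μ p).subtype

theorem toFun_injective : Function.Injective (toFun : Ap μ p → G → ℂ) :=
  Subtype.val_injective

theorem toFun_mem (u : Ap μ p) : toFun u ∈ herzSubmodule μ p := u.2

theorem herzENorm_lt_top (u : Ap μ p) : herzENorm μ p (toFun u) < ∞ :=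
  herzENorm_lt_top_iff.2 u.2

/-- The norm of `A_p(G)`: `‖u‖ = inf ∑ᵢ ‖fᵢ‖_p ‖gᵢ‖_q` over all representations of `u`. -/
def herzNorm (u : Ap μ p) : ℝ := (herzENorm μ p (toFun u)).toReal

theorem ofReal_herzNorm (u : Ap μ p) : ENNReal.ofReal (herzNorm u) = herzENorm μ p (toFun u) :=
  ENNReal.ofReal_toReal (herzENorm_lt_top u).ne

theorem norm_apply_le_herzNorm (u : Ap μ p) (x : G) : ‖toFun u x‖ ≤ herzNorm u := by
  have := enorm_apply_le_herzENorm μ p (toFun u) x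
  rw [← ofReal_herzNorm] at this
  rwa [← ENNReal.ofReal_le_ofReal_iff (by rw [herzNorm]; exact ENNReal.toReal_nonneg),
    _root_.ofReal_norm]

theorem herzNorm_smul_le (c : ℂ) (u : Ap μ p) : herzNorm (c • u) ≤ ‖c‖ * herzNorm u := by
  have := herzENorm_smul_le μ p c (toFun u)
  rw [← map_smul] at this
  have h2 := ENNReal.toReal_mono
    (ENNReal.mul_lt_top (by simp) (herzENorm_lt_top u)).ne this
  simpa [herzNorm] using h2

instance : NormedAddCommGroup (Ap μ p) :=
  AddGroupNorm.toNormedAddCommGroup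
    { toFun := herzNorm
      map_zero' := by simp [herzNorm, herzENorm_zero]
      add_le' := fun u v => by
        have := herzENorm_add_le μ p (toFun u) (toFun v)
        rw [← map_add] at this
        rw [herzNorm, herzNorm, herzNorm,
          ← ENNReal.toReal_add (herzENorm_lt_top u).ne (herzENorm_lt_top v).ne]
        exact ENNReal.toReal_mono
          (ENNReal.add_lt_top.2 ⟨herzENorm_lt_top u, herzENorm_lt_top v⟩).ne this
      neg' := fun u => by
        have h : ∀ v : Ap μ p, herzNorm (-v) ≤ herzNorm v := fun v => by
          simpa using herzNorm_smul_le (-1 : ℂ) v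
        exact le_antisymm (h u) (by simpa using h (-u))
      eq_zero_of_map_eq_zero' := fun u hu => by
        refine toFun_injective (funext fun x => ?_)
        have := norm_apply_le_herzNorm u x
        rw [hu] at this
        simpa using this }

instance : NormedSpace ℂ (Ap μ p) where
  norm_smul_le := herzNorm_smul_le

theorem norm_def (u : Ap μ p) : ‖u‖ = (herzENorm μ p (toFun u)).toReal := rfl

theorem ofReal_norm (u : Ap μ p) : ENNReal.ofReal ‖u‖ = herzENorm μ p (toFun u) :=
  ofReal_herzNorm u

theorem norm_apply_le (u : Ap μ p) (x : G) : ‖toFun u x‖ ≤ ‖u‖ := norm_apply_le_herzNorm u x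

/-- `A_p(G)` is complete. -/
instance : CompleteSpace (Ap μ p) := by
  refine NormedAddCommGroup.completeSpace_of_summable_imp_tendsto fun u hu => ?_
  have hx : ∀ x, Summable fun n => toFun (u n) x := fun x =>
    Summable.of_norm_bounded hu fun n => norm_apply_le (u n) x
  have hE : ∑' n, herzENorm μ p (toFun (u n)) ≠ ∞ := by
    simp_rw [← ofReal_norm]
    exact hu.tsum_ofReal_ne_top
  let U : G → ℂ := fun x => ∑' n, toFun (u n) x
  have hU : U ∈ herzSubmodule μ p :=
    herzENorm_lt_top_iff.1 ((herzENorm_le_tsum μ p (fun n => toFun (u n)) U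
      fun x => (hx x).hasSum).trans_lt hE.lt_top)
  let a : Ap μ p := ⟨U, hU⟩
  refine ⟨a, ?_⟩
  rw [tendsto_iff_norm_sub_tendsto_zero]
  have htail : Tendsto (fun n => (∑' k, herzENorm μ p (toFun (u (k + n)))).toReal) atTop (𝓝 0) := by
    have := ENNReal.tendsto_sum_nat_add _ hE
    exact (ENNReal.tendsto_toReal ENNReal.zero_ne_top).comp this
  refine squeeze_zero (fun _ => norm_nonneg _) (fun n => ?_) htail
  rw [norm_sub_rev, norm_def]
  refine ENNReal.toReal_mono ?_ (herzENorm_le_tsum μ p (fun k => toFun (u (k + n))) _ fun x => ?_)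
  · exact (lt_of_le_of_lt (ENNReal.tsum_comp_le_tsum_of_injective
      (add_left_injective n) fun k => herzENorm μ p (toFun (u k))) hE.lt_top).ne
  · have h1 : toFun (a - ∑ i ∈ Finset.range n, u i) x =
        U x - ∑ i ∈ Finset.range n, toFun (u i) x := by
      rw [map_sub, map_sum]
      simp only [Pi.sub_apply, Finset.sum_apply]
      rfl
    rw [h1]
    exact (hasSum_nat_add_iff' (f := fun k => toFun (u k) x) n).2 (hx x).hasSum

/-- For a compact neighbourhood `K` of `e`, the function `1_{xK} * 1_K^∨` of `A_p(G)` attains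
its norm at `x`. -/
theorem exists_apply_eq_norm [LocallyCompactSpace G] (x : G) :
    ∃ v : Ap μ p, toFun v x ≠ 0 ∧ ‖v‖ ≤ ‖toFun v x‖ := by
  obtain ⟨K, hK, hK1⟩ := exists_compact_mem_nhds (1 : G)
  -- replace `K` by its closure to get a measurable set
  have hKc : IsCompact (closure K) := hK.closure
  have hKm : MeasurableSet (closure K) := isClosed_closure.measurableSet
  have hK1' : closure K ∈ 𝓝 (1 : G) := mem_of_superset hK1 subset_closure
  set C := closure K
  have hpos : μ C ≠ 0 := (Measure.measure_pos_of_mem_nhds μ hK1').ne'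
  have hfin : μ C ≠ ∞ := hKc.measure_lt_top.ne
  let D : Set G := (fun y => x⁻¹ * y) ⁻¹' C
  have hDm : MeasurableSet D := hKm.preimage (measurable_const_mul x⁻¹)
  have hD : μ D = μ C := measure_preimage_mul μ x⁻¹ C
  have hp0 : p ≠ 0 := (zero_lt_one.trans_le (Fact.out : 1 ≤ p)).ne'
  have hq0 : p.conjExponent ≠ 0 := ENNReal.HolderConjugate.ne_zero p.conjExponent p
  let f : ℕ → G → ℂ := fun n => if n = 0 then C.indicator fun _ => 1 else 0
  let g : ℕ → G → ℂ := fun n => if n = 0 then D.indicator fun _ => 1 else 0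
  have hcost : ∑' i, eLpNorm (f i) p μ * eLpNorm (g i) p.conjExponent μ = μ C := by
    rw [tsum_eq_single 0 fun n hn => by simp [f, hn]]
    simp only [f, g, if_true]
    rw [eLpNorm_indicator_const' hKm hpos hp0, eLpNorm_indicator_const' hDm (hD ▸ hpos) hq0, hD]
    simp only [enorm_one, one_mul]
    rw [← ENNReal.rpow_add _ _ hpos hfin]
    have h1 := ENNReal.HolderConjugate.inv_add_inv_eq_one p p.conjExponent
    have h2 := congrArg ENNReal.toReal h1
    rw [ENNReal.toReal_add (by simpa using hp0) (by simpa using hq0), ENNReal.toReal_inv,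
      ENNReal.toReal_inv] at h2
    simp only [one_div, h2, ENNReal.toReal_one, ENNReal.rpow_one]
  have hval : conv μ (g 0) (check (f 0)) x = (μ C).toReal := by
    have : ∀ y, g 0 y * check (f 0) (y⁻¹ * x) = D.indicator (fun _ => (1 : ℂ)) y := by
      intro y
      by_cases hy : x⁻¹ * y ∈ C <;> simp [f, g, check, D, Set.indicator, hy]
    simp only [conv, this]
    rw [integral_indicator_const _ hDm]
    simp [Measure.real, hD]
  let U : G → ℂ := fun z => conv μ (g 0) (check (f 0)) z
  have hrep : IsHerzRep μ p U f g := by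
    refine ⟨fun i => ?_, fun i => ?_, hcost ▸ hfin.lt_top, fun z => ?_⟩
    · by_cases hi : i = 0
      · simpa [f, hi] using memLp_indicator_const p hKm (1 : ℂ) (.inr hfin)
      · simp [f, hi]
    · by_cases hi : i = 0
      · simpa [g, hi] using memLp_indicator_const p.conjExponent hDm (1 : ℂ) (.inr (hD ▸ hfin))
      · simp [g, hi]
    · exact hasSum_single 0 fun n hn => by simp [conv, g, hn]
  refine ⟨⟨U, f, g, hrep⟩, ?_, ?_⟩
  · change conv μ (g 0) (check (f 0)) x ≠ 0
    rw [hval]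
    exact_mod_cast (ENNReal.toReal_pos hpos hfin).ne'
  · change (herzENorm μ p U).toReal ≤ ‖conv μ (g 0) (check (f 0)) x‖
    rw [hval, Complex.norm_real, Real.norm_of_nonneg ENNReal.toReal_nonneg]
    exact ENNReal.toReal_mono hfin ((herzENorm_le hrep).trans hcost.le)

end Ap

end Norm

section Multipliers

variable {G : Type*} [Group G] [TopologicalSpace G] [IsTopologicalGroup G]
  [MeasurableSpace G] [BorelSpace G]

/-- The bounded continuous functions `u` on `G` with `u v ∈ A_p(G)` for all `v ∈ A_p(G)`. -/
def multSubalgebra (μ : Measure G) [μ.IsHaarMeasure] (p : ℝ≥0∞) [Fact (1 ≤ p)] :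
    Subalgebra ℂ (G →ᵇ ℂ) where
  carrier := {u | ∀ v ∈ herzSubmodule μ p, (fun x => u x * v x) ∈ herzSubmodule μ p}
  mul_mem' := fun {u w} hu hw v hv => by
    simpa [mul_assoc] using hu _ (hw v hv)
  add_mem' := fun {u w} hu hw v hv => by
    have h : (fun x => (u + w) x * v x) = (fun x => u x * v x) + fun x => w x * v x := by
      funext x; simp [add_mul]
    rw [h]
    exact add_mem (hu v hv) (hw v hv)
  algebraMap_mem' := fun c v hv => by
    have h : (fun x => (algebraMap ℂ (G →ᵇ ℂ) c) x * v x) = c • v := by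
      funext x; simp [BoundedContinuousFunction.algebraMap_apply]
    rw [h]
    exact Submodule.smul_mem _ c hv

/-- The multiplier algebra `B_p(G)`, with pointwise operations. It carries the multiplier norm
(defined below), not the supremum norm. -/
def Bp (μ : Measure G) [μ.IsHaarMeasure] (p : ℝ≥0∞) [Fact (1 ≤ p)] : Type _ :=
  multSubalgebra μ p

namespace Bp

variable {μ : Measure G} [μ.IsHaarMeasure] {p : ℝ≥0∞} [Fact (1 ≤ p)]

instance : CommRing (Bp μ p) := inferInstanceAs (CommRing (multSubalgebra μ p))

instance : Algebra ℂ (Bp μ p) := inferInstanceAs (Algebra ℂ (multSubalgebra μ p))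

/-- The inclusion of `B_p(G)` into the bounded continuous functions on `G`. -/
def toBCF : Bp μ p →ₐ[ℂ] (G →ᵇ ℂ) := (multSubalgebra μ p).val

theorem toBCF_injective : Function.Injective (toBCF : Bp μ p → (G →ᵇ ℂ)) :=
  Subtype.val_injective

/-- Multiplication `v ↦ u v` of `A_p(G)` by `u ∈ B_p(G)`. -/
def multₗ (u : Bp μ p) : Ap μ p →ₗ[ℂ] Ap μ p where
  toFun v := ⟨fun x => toBCF u x * Ap.toFun v x, u.2 _ v.2⟩
  map_add' _ _ := Ap.toFun_injective (funext fun _ => mul_add _ _ _)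
  map_smul' _ _ := Ap.toFun_injective (funext fun _ => mul_left_comm _ _ _)

theorem toFun_multₗ (u : Bp μ p) (v : Ap μ p) (x : G) :
    Ap.toFun (multₗ u v) x = toBCF u x * Ap.toFun v x := rfl

/-- Multiplication by `u ∈ B_p(G)` is bounded on `A_p(G)` (closed graph theorem). -/
def mult (u : Bp μ p) : Ap μ p →L[ℂ] Ap μ p :=
  ContinuousLinearMap.ofSeqClosedGraph (g := multₗ u) (by
    intro v a b ha hb
    have hev : ∀ {w : ℕ → Ap μ p} {c : Ap μ p}, Tendsto w atTop (𝓝 c) → ∀ x,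
        Tendsto (fun n => Ap.toFun (w n) x) atTop (𝓝 (Ap.toFun c x)) := by
      intro w c hw x
      rw [tendsto_iff_norm_sub_tendsto_zero] at hw ⊢
      refine squeeze_zero (fun _ => norm_nonneg _) (fun n => ?_) hw
      simpa using Ap.norm_apply_le (w n - c) x
    refine Ap.toFun_injective (funext fun x => ?_)
    exact tendsto_nhds_unique (hev hb x) ((hev ha x).const_mul (toBCF u x)))

theorem toFun_mult (u : Bp μ p) (v : Ap μ p) (x : G) :
    Ap.toFun (mult u v) x = toBCF u x * Ap.toFun v x := rfl

/-- The multiplier norm `‖u‖ = sup {‖u v‖_{A_p} : ‖v‖_{A_p} ≤ 1}`. -/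
def multNorm (u : Bp μ p) : ℝ :=
  sSup ((fun v : Ap μ p => ‖mult u v‖) '' {v | ‖v‖ ≤ 1})

theorem multNorm_eq (u : Bp μ p) : multNorm u = ‖mult u‖ := by
  rw [multNorm, ← ContinuousLinearMap.sSup_unitClosedBall_eq_norm]
  congr 2
  ext v
  simp

theorem mult_add (u w : Bp μ p) : mult (u + w) = mult u + mult w := by
  refine ContinuousLinearMap.ext fun v => Ap.toFun_injective (funext fun x => ?_)
  simp [toFun_mult, add_mul]

theorem mult_mul (u w : Bp μ p) : mult (u * w) = (mult u).comp (mult w) := by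
  refine ContinuousLinearMap.ext fun v => Ap.toFun_injective (funext fun x => ?_)
  simp [toFun_mult, mul_assoc]

theorem mult_smul (c : ℂ) (u : Bp μ p) : mult (c • u) = c • mult u := by
  refine ContinuousLinearMap.ext fun v => Ap.toFun_injective (funext fun x => ?_)
  simp [toFun_mult, mul_assoc]

variable [LocallyCompactSpace G]

theorem norm_apply_le_multNorm (u : Bp μ p) (x : G) : ‖toBCF u x‖ ≤ multNorm u := by
  obtain ⟨v, hv0, hv⟩ := Ap.exists_apply_eq_norm (μ := μ) (p := p) x
  have h : ‖toBCF u x‖ * ‖Ap.toFun v x‖ ≤ multNorm u * ‖Ap.toFun v x‖ := by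
    rw [← norm_mul, ← toFun_mult, multNorm_eq]
    exact (Ap.norm_apply_le _ x).trans (((mult u).le_opNorm v).trans (by gcongr))
  exact le_of_mul_le_mul_right h (norm_pos_iff.2 hv0)

instance : NormedCommRing (Bp μ p) where
  __ := RingNorm.toNormedRing
    { toFun := multNorm
      map_zero' := by
        rw [multNorm_eq, ← zero_smul ℂ (0 : Bp μ p), mult_smul]; simp
      add_le' := fun u w => by
        simp only [multNorm_eq, mult_add]; exact norm_add_le _ _
      neg' := fun u => by
        rw [multNorm_eq, multNorm_eq, ← neg_one_smul ℂ u, mult_smul]; simp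
      mul_le' := fun u w => by
        simp only [multNorm_eq, mult_mul]; exact ContinuousLinearMap.opNorm_comp_le _ _
      eq_zero_of_map_eq_zero' := fun u hu => by
        refine toBCF_injective (BoundedContinuousFunction.ext fun x => ?_)
        have h := norm_apply_le_multNorm u x
        rw [hu] at h
        simpa using h }
  mul_comm := mul_comm

theorem norm_def (u : Bp μ p) : ‖u‖ = multNorm u := rfl

instance : NormedAlgebra ℂ (Bp μ p) where
  norm_smul_le c u := by
    simp only [norm_def, multNorm_eq, mult_smul]; exact norm_smul_le c (mult u)

theorem norm_apply_le (u : Bp μ p) (x : G) : ‖toBCF u x‖ ≤ ‖u‖ := norm_apply_le_multNorm u x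

end Bp

variable [LocallyCompactSpace G] (μ : Measure G) [μ.IsHaarMeasure] (p : ℝ≥0∞) [Fact (1 ≤ p)]

/-- The functional `I(u) = u(e)` on `B_p(G)`. -/
def evalOne : StrongDual ℂ (Bp μ p) :=
  LinearMap.mkContinuous
    { toFun := fun u => Bp.toBCF u 1
      map_add' := fun u w => by simp
      map_smul' := fun c u => by simp }
    1 fun u => by simpa using Bp.norm_apply_le u 1

variable {μ p}

theorem evalOne_apply (u : Bp μ p) : evalOne μ p u = Bp.toBCF u 1 := rfl

/-- The module action of `B_p(G)` on `B_p(G)^*`: `⟨u T, v⟩ = ⟨T, u v⟩`. -/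
def act (u : Bp μ p) (T : StrongDual ℂ (Bp μ p)) : StrongDual ℂ (Bp μ p) :=
  T.comp (ContinuousLinearMap.mul ℂ (Bp μ p) u)

theorem act_apply (u : Bp μ p) (T : StrongDual ℂ (Bp μ p)) (v : Bp μ p) :
    act u T v = T (u * v) := rfl

/-- The image in `B_p(G)^*`, with its weak topology `σ(B_p^*, B_p^**)`, of the orbit
`{u T : ‖u‖ ≤ 1}`. -/
def weakOrbit (T : StrongDual ℂ (Bp μ p)) : Set (WeakSpace ℂ (StrongDual ℂ (Bp μ p))) :=
  (fun u => toWeakSpace ℂ (StrongDual ℂ (Bp μ p)) (act u T)) '' {u | ‖u‖ ≤ 1}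

/-- `T ∈ B_p(G)^*` is weakly almost periodic if `{u T : ‖u‖ ≤ 1}` is relatively compact in the
weak topology of the Banach space `B_p(G)^*`. -/
def IsWAP (T : StrongDual ℂ (Bp μ p)) : Prop :=
  IsCompact (closure (weakOrbit T))

theorem isWAP_of_subset {T : StrongDual ℂ (Bp μ p)}
    {K : Set (WeakSpace ℂ (StrongDual ℂ (Bp μ p)))} (hK : IsCompact K)
    (h : ∀ u : Bp μ p, ‖u‖ ≤ 1 → toWeakSpace ℂ (StrongDual ℂ (Bp μ p)) (act u T) ∈ K) :
    IsWAP T :=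
  hK.closure_of_subset (by rintro _ ⟨u, hu, rfl⟩; exact h u hu)

theorem mem_weakOrbit_closure (T : StrongDual ℂ (Bp μ p)) {u : Bp μ p} (hu : ‖u‖ ≤ 1) :
    toWeakSpace ℂ (StrongDual ℂ (Bp μ p)) (act u T) ∈ closure (weakOrbit T) :=
  subset_closure ⟨u, hu, rfl⟩

theorem IsWAP.zero : IsWAP (0 : StrongDual ℂ (Bp μ p)) :=
  isWAP_of_subset isCompact_singleton fun _ _ => map_zero (toWeakSpace ℂ _)

theorem IsWAP.add {S T : StrongDual ℂ (Bp μ p)} (hS : IsWAP S) (hT : IsWAP T) :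
    IsWAP (S + T) :=
  isWAP_of_subset ((hS.prod hT).image continuous_add) fun u hu =>
    ⟨(_, _), ⟨mem_weakOrbit_closure S hu, mem_weakOrbit_closure T hu⟩,
      (map_add (toWeakSpace ℂ _) (act u S) (act u T)).symm⟩

theorem IsWAP.smul (c : ℂ) {T : StrongDual ℂ (Bp μ p)} (hT : IsWAP T) : IsWAP (c • T) :=
  isWAP_of_subset (hT.image (continuous_const_smul c)) fun u hu =>
    ⟨_, mem_weakOrbit_closure T hu, (map_smul (toWeakSpace ℂ _) c (act u T)).symm⟩

variable (μ p) in
/-- The subspace of weakly almost periodic functionals in `B_p(G)^*`. -/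
def wapSubmodule : Submodule ℂ (StrongDual ℂ (Bp μ p)) where
  carrier := {T | IsWAP T}
  zero_mem' := IsWAP.zero
  add_mem' := IsWAP.add
  smul_mem' := fun c _ hT => IsWAP.smul c hT

theorem mem_wapSubmodule {T : StrongDual ℂ (Bp μ p)} : T ∈ wapSubmodule μ p ↔ IsWAP T := Iff.rfl

theorem act_evalOne (u : Bp μ p) : act u (evalOne μ p) = Bp.toBCF u 1 • evalOne μ p := by
  ext v
  simp [act_apply, evalOne_apply]

theorem evalOne_mem_wapSubmodule : evalOne μ p ∈ wapSubmodule μ p :=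
  isWAP_of_subset (K := (fun c : ℂ => c • toWeakSpace ℂ _ (evalOne μ p)) '' Metric.closedBall 0 1)
    ((isCompact_closedBall 0 1).image (continuous_id.smul continuous_const)) fun u hu =>
    ⟨Bp.toBCF u 1, by simpa using (Bp.norm_apply_le u 1).trans hu, by
      rw [act_evalOne, map_smul]⟩

theorem act_mem_wapSubmodule (u : Bp μ p) {T : StrongDual ℂ (Bp μ p)} (hT : T ∈ wapSubmodule μ p) :
    act u T ∈ wapSubmodule μ p := by
  set c : ℂ := ((‖u‖ + 1 : ℝ) : ℂ) with hc
  have hpos : (0 : ℝ) < ‖u‖ + 1 := by positivity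
  have hc0 : c ≠ 0 := by rw [hc]; exact_mod_cast hpos.ne'
  refine isWAP_of_subset ((mem_wapSubmodule.1 hT).image (continuous_const_smul c)) fun w hw => ?_
  refine ⟨_, mem_weakOrbit_closure T (u := c⁻¹ • (u * w)) ?_, ?_⟩
  · rw [norm_smul, norm_inv, hc, Complex.norm_real, Real.norm_of_nonneg hpos.le,
      inv_mul_le_iff₀ hpos, mul_one]
    nlinarith [norm_mul_le u w, norm_nonneg u, norm_nonneg w]
  · change toWeakSpace ℂ _ (c • act (c⁻¹ • (u * w)) T) = _
    congr 1
    ext v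
    simp [act_apply, mul_assoc, hc0]

variable (μ p) in
/-- `wap(B_p(G))`, the space of weakly almost periodic functionals on `B_p(G)`, with the norm of
`B_p(G)^*`. -/
def Wap : Type _ := wapSubmodule μ p

namespace Wap

instance : NormedAddCommGroup (Wap μ p) := inferInstanceAs (NormedAddCommGroup (wapSubmodule μ p))

instance : NormedSpace ℂ (Wap μ p) := inferInstanceAs (NormedSpace ℂ (wapSubmodule μ p))

/-- The inclusion of `wap(B_p(G))` into `B_p(G)^*`. -/
def incl : Wap μ p →ₗᵢ[ℂ] StrongDual ℂ (Bp μ p) := (wapSubmodule μ p).subtypeₗᵢ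

/-- The functional `I(u) = u(e)`, as an element of `wap(B_p(G))`. -/
def I : Wap μ p := ⟨evalOne μ p, evalOne_mem_wapSubmodule⟩

theorem incl_I : incl (I : Wap μ p) = evalOne μ p := rfl

/-- The module action `(u, T) ↦ u T` of `B_p(G)` on `wap(B_p(G))`. -/
def smulB (u : Bp μ p) (T : Wap μ p) : Wap μ p := ⟨act u (incl T), act_mem_wapSubmodule u T.2⟩

theorem incl_smulB (u : Bp μ p) (T : Wap μ p) : incl (smulB u T) = act u (incl T) := rfl

end Wap

/-- Topological invariance of `F ∈ wap(B_p(G))^*`: `F(u T) = u(e) F(T)` for all `u ∈ B_p(G)` and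
`T ∈ wap(B_p(G))`. -/
def IsTopInvariant (F : StrongDual ℂ (Wap μ p)) : Prop :=
  ∀ (u : Bp μ p) (T : Wap μ p), F (Wap.smulB u T) = Bp.toBCF u 1 * F T

/-- A mean on `wap(B_p(G))`: `‖F‖ = F(I) = 1`. -/
def IsMean (F : StrongDual ℂ (Wap μ p)) : Prop :=
  ‖F‖ = 1 ∧ F Wap.I = 1

end Multipliers

end Herz

end

/-! Let `w = k * h^∨`, where `k, h` are continuous, supported in a small neighbourhood of `e`, and
`‖k‖_q = ‖h‖_p = ∫ k h = 1`. Then `w(e) = 1` and `‖w‖ ≤ 1` in `B_p(G)`. The heart of the proof is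
that `‖u w - u(e) w‖ → 0` for every `u ∈ B_p(G)` as the supports shrink to `e`
(`Bp.tendsto_mul_ofPairing_sub`).

Existence follows by compactness: a weak-* limit of the functionals `T ↦ T(w)` along an ultrafilter
is an invariant mean (`exists_topInvariant_mean`).

For uniqueness, let `T` be weakly almost periodic. Along an ultrafilter the functionals `w T`
converge weakly to some `R`, and `R(v) = lim T(v w) = v(e) lim T(w)`, so `R = c I` with `c = lim
T(w)`. If `F` is invariant with `F(I) = 1`, a Hahn-Banach extension of `F` takes the value `c` at
`R`, and also the value `lim F(w T) = lim w(e) F(T) = F(T)`. Hence `F(T) = c` does not depend on `F`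
(`tendsto_of_topInvariant`).

The asymptotics rest on the product formula `(k * h^∨)(g * f^∨) = ∫ (k g(· t)) * (h f(· t))^∨ dt`, a
consequence of left invariance (`toFun_integral_prodIntegrand`). With Hölder in `t` it shows that
`A_p(G)` is a normed algebra (`herzENorm_mul_le`), so that the multiplier norm is at most the `A_p`
norm. When `k, h` have small support, `k(z) g(z t)` is close to `g(t) k(z)`, so the integral is
close to `(∫ g f) w = (g * f^∨)(e) w`. Density extends this to `A_p(G)`, and multiplication by one
fixed `w₀` with `w₀(e) = 1` carries it over to `B_p(G)`. -/

open scoped CompactlySupported Pointwise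

noncomputable section

namespace Herz

/-! ### Density of compactly supported continuous functions in `L^r`. -/

section Density

variable {X : Type*} [TopologicalSpace X] [R1Space X] [LocallyCompactSpace X]
  [MeasurableSpace X] [BorelSpace X] {μ : Measure X} [μ.Regular] {r : ℝ≥0∞}

/-- Unlike `MemLp.exists_hasCompactSupport_eLpNorm_sub_le`, this does not need `X` to be normal. -/
theorem exists_hasCompactSupport_eLpNorm_sub_le (hr : r ≠ ∞) {f : X → ℂ} (hf : MemLp f r μ)
    {ε : ℝ≥0∞} (hε : ε ≠ 0) :
    ∃ g : X → ℂ, eLpNorm (f - g) r μ ≤ ε ∧ Continuous g ∧ HasCompactSupport g := by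
  refine hf.induction_dense hr (fun g => Continuous g ∧ HasCompactSupport g) ?_ ?_ ?_ hε
  · intro c t ht htμ ε hε
    rcases exists_Lp_half ℂ μ r hε with ⟨δ, δpos, hδ⟩
    obtain ⟨η, ηpos, hη⟩ := exists_eLpNorm_indicator_le (μ := μ) hr c δpos.ne'
    have hη_pos' : (0 : ℝ≥0∞) < η := ENNReal.coe_pos.2 ηpos
    obtain ⟨s, st, s_compact, s_closed, μs⟩ := ht.exists_isCompact_isClosed_sdiff_lt htμ.ne
      hη_pos'.ne'
    have hsμ : μ s < ∞ := (measure_mono st).trans_lt htμ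
    obtain ⟨V, sV, V_open, h'V, hV⟩ : ∃ (V : Set X), V ⊇ s ∧ IsOpen V ∧ μ V < ∞ ∧ μ (V \ s) < η :=
      s_closed.measurableSet.exists_isOpen_sdiff_lt hsμ.ne hη_pos'.ne'
    -- Compactness of `s` replaces normality: a compact set and a disjoint closed set can be
    -- separated by a continuous function in any locally compact R1 space.
    obtain ⟨g, hgs, hgV, hgc, hg_range⟩ := exists_continuous_one_zero_of_isCompact s_compact
      V_open.isClosed_compl (Set.disjoint_compl_right_iff_subset.2 sV)
    have I1 : eLpNorm ((s.indicator fun _y => c) - t.indicator fun _y => c) r μ ≤ δ := by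
      rw [← eLpNorm_neg, neg_sub, ← Set.indicator_sdiff st]
      exact hη _ μs.le
    have gc_bd : ∀ x, ‖g x • c - s.indicator (fun _x => c) x‖ ≤
        ‖(V \ s).indicator (fun _x => c) x‖ := by
      intro x
      by_cases hv : x ∈ V
      · by_cases hs : x ∈ s
        · simp [hgs hs, hs]
        · have := (hg_range x)
          simp only [hs, hv, not_false_eq_true, Set.indicator_of_notMem, sub_zero, Set.mem_sdiff,
            and_self, Set.indicator_of_mem, norm_smul, Real.norm_eq_abs, abs_of_nonneg this.1]
          exact mul_le_of_le_one_left (norm_nonneg _) this.2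
      · simp [hgV hv, show x ∉ s from fun h => hv (sV h)]
    have I2 : eLpNorm ((fun x => g x • c) - s.indicator fun _x => c) r μ ≤ δ :=
      (eLpNorm_mono gc_bd).trans (hη _ hV.le)
    have hcont : Continuous fun x => g x • c := by fun_prop
    refine ⟨fun x => g x • c, ?_, hcont, hgc.smul_right⟩
    have := hδ _ _ (hcont.aestronglyMeasurable.sub
            (aestronglyMeasurable_const.indicator s_closed.measurableSet))
          ((aestronglyMeasurable_const.indicator s_closed.measurableSet).sub
            (aestronglyMeasurable_const.indicator ht))
          I2 I1
    simpa using this.le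
  · rintro f g ⟨hf, hf'⟩ ⟨hg, hg'⟩
    exact ⟨hf.add hg, hf'.add hg'⟩
  · rintro f ⟨hf, hf'⟩
    exact hf.aestronglyMeasurable

end Density

section CompactSupport

variable {X : Type*} [TopologicalSpace X] [MeasurableSpace X] [BorelSpace X]

theorem memLp_cc (μ : Measure X) [IsFiniteMeasureOnCompacts μ] (r : ℝ≥0∞) (f : C_c(X, ℂ)) :
    MemLp f r μ :=
  (map_continuous f).memLp_of_hasCompactSupport f.hasCompactSupport

/-- The class in `L^r` of a compactly supported continuous function. -/
def ccToLp (μ : Measure X) [IsFiniteMeasureOnCompacts μ] (r : ℝ≥0∞) :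
    C_c(X, ℂ) →ₗ[ℂ] Lp ℂ r μ where
  toFun f := (memLp_cc μ r f).toLp
  map_add' _ _ := rfl
  map_smul' _ _ := rfl

theorem coeFn_ccToLp (μ : Measure X) [IsFiniteMeasureOnCompacts μ] (r : ℝ≥0∞) (f : C_c(X, ℂ)) :
    ccToLp μ r f =ᵐ[μ] f :=
  MemLp.coeFn_toLp (memLp_cc μ r f)

theorem denseRange_ccToLp [R1Space X] [LocallyCompactSpace X] (μ : Measure X) [μ.Regular]
    {r : ℝ≥0∞} [Fact (1 ≤ r)] (hr : r ≠ ∞) : DenseRange (ccToLp μ r) := by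
  intro f
  rw [Metric.mem_closure_range_iff]
  intro ε hε
  obtain ⟨g, hg, hgc, hgs⟩ := exists_hasCompactSupport_eLpNorm_sub_le hr (Lp.memLp f)
    (ε := ENNReal.ofReal (ε / 2)) (by simpa using hε)
  refine ⟨⟨⟨g, hgc⟩, hgs⟩, ?_⟩
  rw [dist_edist, Lp.edist_def]
  refine lt_of_le_of_lt (ENNReal.toReal_le_of_le_ofReal (by positivity)
    ((eLpNorm_congr_ae ?_).trans_le hg)) (half_lt_self hε)
  exact EventuallyEq.rfl.sub (coeFn_ccToLp μ r ⟨⟨g, hgc⟩, hgs⟩)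

end CompactSupport

/-! ### Extending bounds of countably subadditive functionals from a dense subgroup. -/

section Extension

/-- A countably subadditive functional on a normed space that is bounded by `C ‖·‖` on a dense
subgroup is bounded by `C ‖·‖` everywhere. -/
theorem le_of_dense_of_tsum_le {E : Type*} [NormedAddCommGroup E] {N : E → ℝ≥0∞} {C : ℝ}
    (hC : 0 ≤ C)
    (hN : ∀ (v : ℕ → E) (a : E), Summable (fun n => ‖v n‖) → HasSum v a → N a ≤ ∑' n, N (v n))
    {D : AddSubgroup E} (hD : Dense (D : Set E)) (hND : ∀ v ∈ D, N v ≤ ENNReal.ofReal (C * ‖v‖))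
    (a : E) : N a ≤ ENNReal.ofReal (C * ‖a‖) := by
  have key : ∀ ε > 0, N a ≤ ENNReal.ofReal (C * (‖a‖ + 2 * ε)) := by
    intro ε hε
    -- Write `a` as a series in `D` whose first term has norm at most `‖a‖ + ε / 2` and whose later
    -- terms have norms at most `ε / 2 ^ (n + 1)`. The norms then sum to at most `‖a‖ + ε`.
    obtain ⟨v, hv, hvD, hv0, hvn⟩ := controlled_sum_of_mem_closure (hD a)
      (b := fun n => ε / 2 * (1 / 2) ^ n) (fun n => by positivity)
    have hgeo : HasSum (fun n : ℕ => ε / 2 * (1 / 2) ^ n) ε := by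
      simpa using hasSum_geometric_two.mul_left (ε / 2)
    have hbd : ∀ n, ‖v n‖ ≤ (if n = 0 then ‖a‖ else 0) + ε / 2 * (1 / 2) ^ n := by
      intro n
      rcases eq_or_ne n 0 with rfl | hn
      · have : v 0 = a - (-v 0 + a) := by abel
        have h2 := norm_sub_le a (-v 0 + a)
        rw [← this] at h2
        have h3 := hv0.le
        simp only [pow_zero, if_true] at h3 ⊢
        linarith
      · simpa [hn] using (hvn n (Nat.pos_of_ne_zero hn)).le
    have hbs : HasSum (fun n => (if n = 0 then ‖a‖ else 0) + ε / 2 * (1 / 2) ^ n) (‖a‖ + ε) :=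
      (hasSum_ite_eq 0 ‖a‖).add hgeo
    have hs : Summable (fun n => ‖v n‖) :=
      Summable.of_nonneg_of_le (fun _ => norm_nonneg _) hbd hbs.summable
    have hsum : HasSum v a := by
      have h1 : Tendsto (fun n => ∑ i ∈ Finset.range n, v i) atTop (𝓝 a) :=
        (tendsto_add_atTop_iff_nat 1).1 hv
      exact hasSum_of_subseq_of_summable hs tendsto_finset_range h1
    refine (hN v a hs hsum).trans ((ENNReal.tsum_le_tsum fun n => hND _ (hvD n)).trans ?_)
    rw [← ENNReal.ofReal_tsum_of_nonneg (fun n => by positivity) (hs.mul_left C), tsum_mul_left]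
    refine ENNReal.ofReal_le_ofReal (mul_le_mul_of_nonneg_left ?_ hC)
    have := hs.tsum_le_tsum hbd hbs.summable
    rw [hbs.tsum_eq] at this
    linarith
  have hlim : Tendsto (fun ε : ℝ => ENNReal.ofReal (C * (‖a‖ + 2 * ε))) (𝓝[>] 0)
      (𝓝 (ENNReal.ofReal (C * (‖a‖ + 2 * 0)))) :=
    ((ENNReal.continuous_ofReal.comp (by fun_prop)).tendsto 0).mono_left nhdsWithin_le_nhds
  have := ge_of_tendsto hlim (eventually_mem_nhdsWithin.mono key)
  simpa using this

end Extension

theorem one_le_conjExponent (p : ℝ≥0∞) : 1 ≤ p.conjExponent := le_self_add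

instance fact_one_le_conjExponent (p : ℝ≥0∞) : Fact (1 ≤ p.conjExponent) :=
  ⟨one_le_conjExponent p⟩

/-! ### The bilinear map `(g, f) ↦ g * f^∨` and the structure of `A_p(G)`. -/

section Pairing

variable {G : Type*} [Group G] [TopologicalSpace G] [IsTopologicalGroup G]
  [MeasurableSpace G] [BorelSpace G] {μ : Measure G} [μ.IsHaarMeasure] {p : ℝ≥0∞}

/-- Since left translation preserves null sets, the convolution is determined at every point, not
only almost everywhere. This makes it well defined on classes in `L^q × L^p`. -/
theorem conv_congr {f f' g g' : G → ℂ} (hg : g =ᵐ[μ] g') (hf : f =ᵐ[μ] f') (x : G) :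
    conv μ g (check f) x = conv μ g' (check f') x := by
  have hmp : MeasurePreserving (fun y => x⁻¹ * y) μ μ := measurePreserving_mul_left μ x⁻¹
  refine integral_congr_ae ?_
  filter_upwards [hg, hmp.quasiMeasurePreserving.ae_eq_comp hf] with y h1 h2
  simp only [check, mul_inv_rev, inv_inv]
  rw [h1]
  exact congrArg _ h2

theorem integrable_conv [Fact (1 ≤ p)] {f g : G → ℂ} (hg : MemLp g p.conjExponent μ)
    (hf : MemLp f p μ) (x : G) : Integrable (fun y => g y * check f (y⁻¹ * x)) μ := by
  have hmp : MeasurePreserving (fun y => x⁻¹ * y) μ μ := measurePreserving_mul_left μ x⁻¹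
  have := (hf.comp_measurePreserving hmp).integrable_mul hg
  refine this.congr (.of_forall fun y => ?_)
  simp [check, mul_comm]

theorem herzENorm_conv_le [Fact (1 ≤ p)] {f g : G → ℂ} (hg : MemLp g p.conjExponent μ)
    (hf : MemLp f p μ) :
    herzENorm μ p (conv μ g (check f)) ≤ eLpNorm g p.conjExponent μ * eLpNorm f p μ := by
  have h : IsHerzRep μ p (conv μ g (check f)) (fun n => if n = 0 then f else 0)
      (fun n => if n = 0 then g else 0) := by
    refine ⟨fun i => ?_, fun i => ?_, ?_, fun x => ?_⟩
    · split_ifs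
      exacts [hf, MemLp.zero]
    · split_ifs
      exacts [hg, MemLp.zero]
    · rw [tsum_eq_single 0 fun n hn => by simp [hn]]
      exact ENNReal.mul_lt_top hf.2 hg.2
    · exact hasSum_single 0 fun n hn => by simp [conv, hn]
  refine (herzENorm_le h).trans ?_
  rw [tsum_eq_single 0 fun n hn => by simp [hn]]
  simp [mul_comm]

variable (μ p) in
/-- The bounded bilinear map `(g, f) ↦ g * f^∨` from `L^q × L^p` to `A_p(G)`. -/
def herzPairing [Fact (1 ≤ p)] : Lp ℂ p.conjExponent μ →L[ℂ] Lp ℂ p μ →L[ℂ] Ap μ p :=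
  LinearMap.mkContinuous₂
    (LinearMap.mk₂ ℂ
      (fun g f => (⟨conv μ g (check f), herzENorm_lt_top_iff.1 ((herzENorm_conv_le (Lp.memLp g)
        (Lp.memLp f)).trans_lt (ENNReal.mul_lt_top (Lp.memLp g).2 (Lp.memLp f).2))⟩ : Ap μ p))
      (fun g g' f => Ap.toFun_injective <| funext fun x => by
        change conv μ _ _ x = conv μ _ _ x + conv μ _ _ x
        rw [conv_congr (Lp.coeFn_add g g') EventuallyEq.rfl]
        simp only [conv, Pi.add_apply, add_mul]
        exact integral_add (integrable_conv (Lp.memLp g) (Lp.memLp f) x)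
          (integrable_conv (Lp.memLp g') (Lp.memLp f) x))
      (fun c g f => Ap.toFun_injective <| funext fun x => by
        change conv μ _ _ x = c * conv μ _ _ x
        rw [conv_congr (Lp.coeFn_smul c g) EventuallyEq.rfl]
        simp only [conv, Pi.smul_apply, smul_eq_mul, mul_assoc]
        exact integral_const_mul _ _)
      (fun g f f' => Ap.toFun_injective <| funext fun x => by
        change conv μ _ _ x = conv μ _ _ x + conv μ _ _ x
        rw [conv_congr EventuallyEq.rfl (Lp.coeFn_add f f')]
        simp only [conv, check, Pi.add_apply, mul_add]
        exact integral_add (integrable_conv (Lp.memLp g) (Lp.memLp f) x)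
          (integrable_conv (Lp.memLp g) (Lp.memLp f') x))
      (fun c g f => Ap.toFun_injective <| funext fun x => by
        change conv μ _ _ x = c * conv μ _ _ x
        rw [conv_congr EventuallyEq.rfl (Lp.coeFn_smul c f)]
        simp only [conv, check, Pi.smul_apply, smul_eq_mul, mul_left_comm _ c]
        exact integral_const_mul _ _))
    1 fun g f => by
      rw [one_mul, Ap.norm_def, Lp.norm_def, Lp.norm_def, ← ENNReal.toReal_mul]
      exact ENNReal.toReal_mono (ENNReal.mul_lt_top (Lp.memLp g).2 (Lp.memLp f).2).ne
        (herzENorm_conv_le (Lp.memLp g) (Lp.memLp f))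

variable [Fact (1 ≤ p)]

theorem toFun_herzPairing_of_ae_eq {g : Lp ℂ p.conjExponent μ} {f : Lp ℂ p μ} {g' f' : G → ℂ}
    (hg : g =ᵐ[μ] g') (hf : f =ᵐ[μ] f') (x : G) :
    Ap.toFun (herzPairing μ p g f) x = conv μ g' (check f') x :=
  conv_congr hg hf x

theorem norm_herzPairing_le (g : Lp ℂ p.conjExponent μ) (f : Lp ℂ p μ) :
    ‖herzPairing μ p g f‖ ≤ ‖g‖ * ‖f‖ := by
  rw [Ap.norm_def, Lp.norm_def, Lp.norm_def, ← ENNReal.toReal_mul]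
  exact ENNReal.toReal_mono (ENNReal.mul_lt_top (Lp.memLp g).2 (Lp.memLp f).2).ne
        (herzENorm_conv_le (Lp.memLp g) (Lp.memLp f))

attribute [irreducible] herzPairing

namespace Ap

variable (μ p) in
/-- Evaluation at a point, as a functional on `A_p(G)`. -/
def evalCLM (x : G) : Ap μ p →L[ℂ] ℂ :=
  LinearMap.mkContinuous ((LinearMap.proj x).comp toFun) 1 fun u => by
    simpa using norm_apply_le u x

theorem evalCLM_apply (x : G) (u : Ap μ p) : evalCLM μ p x u = toFun u x := rfl

/-- Every element of `A_p(G)` is a norm convergent sum of functions `g * f^∨`, with nearly optimal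
cost. -/
theorem exists_hasSum_herzPairing (u : Ap μ p) {ε : ℝ} (hε : 0 < ε) :
    ∃ (g : ℕ → Lp ℂ p.conjExponent μ) (f : ℕ → Lp ℂ p μ),
      Summable (fun n => ‖g n‖ * ‖f n‖) ∧ ∑' n, ‖g n‖ * ‖f n‖ < ‖u‖ + ε ∧
      HasSum (fun n => herzPairing μ p (g n) (f n)) u := by
  have h : herzENorm μ p (toFun u) < ENNReal.ofReal (‖u‖ + ε) := by
    rw [← ofReal_norm]
    exact (ENNReal.ofReal_lt_ofReal_iff (by positivity)).2 (by linarith)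
  obtain ⟨f, g, hrep, hcost⟩ := herzENorm_lt_iff.1 h
  let F := fun n => (hrep.memLp_left n).toLp
  let K := fun n => (hrep.memLp_right n).toLp
  have hterm : ∀ n, eLpNorm (f n) p μ * eLpNorm (g n) p.conjExponent μ =
      ENNReal.ofReal (‖K n‖ * ‖F n‖) := by
    intro n
    rw [Lp.norm_toLp, Lp.norm_toLp, ← ENNReal.toReal_mul, ENNReal.ofReal_toReal, mul_comm]
    exact (ENNReal.mul_lt_top (hrep.memLp_right n).2 (hrep.memLp_left n).2).ne
  simp_rw [hterm] at hcost
  have hs : Summable (fun n => ‖K n‖ * ‖F n‖) := by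
    have := ENNReal.summable_toReal (hcost.trans_le le_top).ne
    refine this.congr fun n => ENNReal.toReal_ofReal (by positivity)
  rw [← ENNReal.ofReal_tsum_of_nonneg (fun n => by positivity) hs,
    ENNReal.ofReal_lt_ofReal_iff (by positivity)] at hcost
  have hsum : Summable (fun n => herzPairing μ p (K n) (F n)) :=
    Summable.of_norm_bounded hs fun n => norm_herzPairing_le _ _
  refine ⟨K, F, hs, hcost, ?_⟩
  -- The series converges in norm to some element of `A_p(G)`. Point evaluations are continuous, so
  -- this element has the same values as `u`.
  convert! hsum.hasSum
  refine toFun_injective (funext fun x => ?_)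
  refine (hrep.hasSum x).unique ?_
  have := hsum.hasSum.mapL (evalCLM μ p x)
  refine this.congr_fun fun n => ?_
  rw [evalCLM_apply]
  exact (toFun_herzPairing_of_ae_eq (MemLp.coeFn_toLp _) (MemLp.coeFn_toLp _) x).symm

/-- A countably subadditive functional on `A_p(G)` that is bounded by `C ‖g‖_q ‖f‖_p` at `g * f^∨`
for compactly supported continuous `f, g` is bounded by `C` times the norm of `A_p(G)`. -/
theorem le_of_cc_of_tsum_le [LocallyCompactSpace G] [μ.Regular] (hp : p ≠ ∞)
    (hq : p.conjExponent ≠ ∞) {N : Ap μ p → ℝ≥0∞} {C : ℝ} (hC : 0 ≤ C)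
    (hN : ∀ (v : ℕ → Ap μ p) (a : Ap μ p), HasSum v a → N a ≤ ∑' n, N (v n))
    (hcc : ∀ g f : C_c(G, ℂ), N (herzPairing μ p (ccToLp μ _ g) (ccToLp μ _ f)) ≤
      ENNReal.ofReal (C * ‖ccToLp μ p.conjExponent g‖ * ‖ccToLp μ p f‖))
    (u : Ap μ p) : N u ≤ ENNReal.ofReal (C * ‖u‖) := by
  -- The bound is extended one variable at a time: in `f` with `g` continuous, then in `g` with `f`
  -- arbitrary, and finally to sums of such products.
  have h1 : ∀ (g : C_c(G, ℂ)) (f : Lp ℂ p μ), N (herzPairing μ p (ccToLp μ _ g) f) ≤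
      ENNReal.ofReal (C * ‖ccToLp μ p.conjExponent g‖ * ‖f‖) := fun g f =>
    le_of_dense_of_tsum_le (N := fun f => N (herzPairing μ p (ccToLp μ _ g) f)) (by positivity)
      (fun v a _ ha => hN _ _ (ha.mapL (herzPairing μ p (ccToLp μ _ g))))
      (D := (ccToLp μ p).range.toAddSubgroup) (denseRange_ccToLp μ hp)
      (by rintro _ ⟨f, rfl⟩; exact hcc g f) f
  have h2 : ∀ (g : Lp ℂ p.conjExponent μ) (f : Lp ℂ p μ), N (herzPairing μ p g f) ≤
      ENNReal.ofReal (C * ‖g‖ * ‖f‖) := fun g f => by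
    rw [mul_right_comm]
    exact le_of_dense_of_tsum_le (N := fun g => N (herzPairing μ p g f)) (by positivity)
      (fun v a _ ha => hN _ _ (ha.mapL ((herzPairing μ p).flip f)))
      (D := (ccToLp μ p.conjExponent).range.toAddSubgroup) (denseRange_ccToLp μ hq)
      (by rintro _ ⟨g, rfl⟩; rw [mul_right_comm]; exact h1 g f) g
  have key : ∀ ε > 0, N u ≤ ENNReal.ofReal (C * (‖u‖ + ε)) := by
    intro ε hε
    obtain ⟨g, f, hs, hcost, hsum⟩ := exists_hasSum_herzPairing u hε
    refine (hN _ _ hsum).trans ((ENNReal.tsum_le_tsum fun n => h2 _ _).trans ?_)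
    simp_rw [mul_assoc]
    rw [← ENNReal.ofReal_tsum_of_nonneg (fun n => by positivity) (hs.mul_left C), tsum_mul_left]
    exact ENNReal.ofReal_le_ofReal (mul_le_mul_of_nonneg_left hcost.le hC)
  have hlim : Tendsto (fun ε : ℝ => ENNReal.ofReal (C * (‖u‖ + ε))) (𝓝[>] 0)
      (𝓝 (ENNReal.ofReal (C * (‖u‖ + 0)))) :=
    ((ENNReal.continuous_ofReal.comp (by fun_prop)).tendsto 0).mono_left nhdsWithin_le_nhds
  simpa using ge_of_tendsto hlim (eventually_mem_nhdsWithin.mono key)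

/-- The functions `g * f^∨` with `f, g` continuous of compact support span a dense subspace. -/
theorem mem_closure_span_cc [LocallyCompactSpace G] [μ.Regular] (hp : p ≠ ∞)
    (hq : p.conjExponent ≠ ∞) (u : Ap μ p) :
    u ∈ (Submodule.span ℂ (Set.range fun x : C_c(G, ℂ) × C_c(G, ℂ) =>
      herzPairing μ p (ccToLp μ _ x.1) (ccToLp μ _ x.2))).topologicalClosure := by
  obtain ⟨g, f, -, -, hsum⟩ := exists_hasSum_herzPairing u one_pos
  refine (Submodule.isClosed_topologicalClosure _).mem_of_tendsto hsum
    (.of_forall fun s => Submodule.sum_mem _ fun n _ => ?_)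
  refine map_mem_closure₂ (f := fun g f => herzPairing μ p g f)
    (herzPairing μ p).continuous₂ (denseRange_ccToLp μ hq (g n)) (denseRange_ccToLp μ hp (f n)) ?_
  rintro _ ⟨g, rfl⟩ _ ⟨f, rfl⟩
  exact Submodule.subset_span ⟨(g, f), rfl⟩

end Ap

end Pairing

/-! ### `L^r` norms of compactly supported continuous functions. -/

section CompactSupportNorm

variable {X : Type*} [TopologicalSpace X] [MeasurableSpace X] [BorelSpace X] {μ : Measure X}
  [IsFiniteMeasureOnCompacts μ] {r : ℝ≥0∞}

theorem norm_ccToLp_eq (hr0 : r ≠ 0) (hr : r ≠ ∞) (f : C_c(X, ℂ)) :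
    ‖ccToLp μ r f‖ = (∫ x, ‖f x‖ ^ r.toReal ∂μ) ^ r.toReal⁻¹ := by
  have h : ‖ccToLp μ r f‖ = (eLpNorm f r μ).toReal := Lp.norm_toLp _ (memLp_cc μ r f)
  rw [h, (memLp_cc μ r f).eLpNorm_eq_integral_rpow_norm hr0 hr, ENNReal.toReal_ofReal]
  exact Real.rpow_nonneg (integral_nonneg fun x => by positivity) _

theorem norm_ccToLp_rpow (hr0 : r ≠ 0) (hr : r ≠ ∞) (f : C_c(X, ℂ)) :
    ‖ccToLp μ r f‖ ^ r.toReal = ∫ x, ‖f x‖ ^ r.toReal ∂μ := by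
  rw [norm_ccToLp_eq hr0 hr, Real.rpow_inv_rpow]
  · exact integral_nonneg fun x => by positivity
  · exact (ENNReal.toReal_pos hr0 hr).ne'

theorem norm_ccToLp_le_mul {f g : C_c(X, ℂ)} {c : ℝ} (h : ∀ x, ‖f x‖ ≤ c * ‖g x‖) :
    ‖ccToLp μ r f‖ ≤ c * ‖ccToLp μ r g‖ := by
  refine Lp.norm_le_mul_norm_of_ae_le_mul ?_
  filter_upwards [coeFn_ccToLp μ r f, coeFn_ccToLp μ r g] with x hf hg
  rw [hf, hg]
  exact h x

theorem exists_norm_le_cc {X : Type*} [TopologicalSpace X] (f : C_c(X, ℂ)) :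
    ∃ M, 0 ≤ M ∧ ∀ x, ‖f x‖ ≤ M := by
  obtain ⟨M, hM⟩ := (f.hasCompactSupport.isCompact_range (map_continuous f)).isBounded.exists_norm_le
  exact ⟨max M 0, le_max_right _ _, fun x => (hM _ ⟨x, rfl⟩).trans (le_max_left _ _)⟩

end CompactSupportNorm

/-- The resulting set of `t` depends on `k` only through `K`. This later confines all the integrals
over `t` to one compact set while `k` varies. -/
theorem mem_of_mul_translate_ne_zero {G : Type*} [Group G] [TopologicalSpace G]
    {k g : C_c(G, ℂ)} {K : Set G}
    (hK : ∀ z, k z ≠ 0 → z ∈ K) {t z : G} (h : k z * g (z * t) ≠ 0) :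
    t ∈ K⁻¹ * tsupport g := by
  have h1 : k z ≠ 0 := left_ne_zero_of_mul h
  have h2 : g (z * t) ≠ 0 := right_ne_zero_of_mul h
  exact ⟨z⁻¹, Set.inv_mem_inv.2 (hK z h1), z * t, subset_tsupport _ h2, by simp⟩

/-! ### Translates `k(z) g(z t)`: continuity in `t` and integrals over `t`. -/

section Translation

variable {G : Type*} [Group G] [TopologicalSpace G] [IsTopologicalGroup G]

/-- Uniform continuity for the right uniformity, in which `t` and `z * t` are close when `z` is near
`1`. -/
theorem eventually_norm_left_mul_sub_le (g : C_c(G, ℂ)) {ε : ℝ} (hε : 0 < ε) :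
    ∀ᶠ z in 𝓝 (1 : G), ∀ t, ‖g (z * t) - g t‖ ≤ ε := by
  let := IsTopologicalGroup.rightUniformSpace G
  have h := g.hasCompactSupport.uniformContinuous_of_continuous (map_continuous g)
  rw [uniformContinuous_iff_eventually] at h
  have h2 := h _ (Metric.dist_mem_uniformity hε)
  rw [uniformity_eq_comap_nhds_one', eventually_comap] at h2
  filter_upwards [h2] with z hz t
  have := hz (t, z * t) (by simp)
  rw [dist_comm, dist_eq_norm] at this
  exact this.le

theorem eventually_norm_right_mul_sub_le (g : C_c(G, ℂ)) {ε : ℝ} (hε : 0 < ε) :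
    ∀ᶠ z in 𝓝 (1 : G), ∀ t, ‖g (t * z) - g t‖ ≤ ε := by
  let := IsTopologicalGroup.leftUniformSpace G
  have h := g.hasCompactSupport.uniformContinuous_of_continuous (map_continuous g)
  rw [uniformContinuous_iff_eventually] at h
  have h2 := h _ (Metric.dist_mem_uniformity hε)
  change ∀ᶠ x in comap (fun p : G × G => p.1⁻¹ * p.2) (𝓝 1), _ at h2
  rw [eventually_comap] at h2
  filter_upwards [h2] with z hz t
  have := hz (t, t * z) (by simp)
  rw [dist_comm, dist_eq_norm] at this
  exact this.le

/-- The function `z ↦ k(z) g(z t)`. -/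
def mulTranslate (k g : C_c(G, ℂ)) (t : G) : C_c(G, ℂ) where
  toFun z := k z * g (z * t)
  continuous_toFun := (map_continuous k).mul ((map_continuous g).comp (continuous_mul_const t))
  hasCompactSupport' := k.hasCompactSupport.mul_right

theorem mulTranslate_apply (k g : C_c(G, ℂ)) (t z : G) : mulTranslate k g t z = k z * g (z * t) :=
  rfl

theorem mulTranslate_eq_zero {k g : C_c(G, ℂ)} {K : Set G} (hK : ∀ z, k z ≠ 0 → z ∈ K) {t : G}
    (ht : t ∉ K⁻¹ * tsupport g) : mulTranslate k g t = 0 := by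
  ext z
  by_contra h
  exact ht (mem_of_mul_translate_ne_zero hK h)

theorem isCompact_inv_mul_tsupport {K : Set G} (hK : IsCompact K) (g : C_c(G, ℂ)) :
    IsCompact (K⁻¹ * tsupport g) :=
  hK.inv.mul g.hasCompactSupport

variable [MeasurableSpace G] [BorelSpace G] {μ : Measure G} [μ.IsHaarMeasure] {r : ℝ≥0∞}

theorem hasCompactSupport_ccToLp_mulTranslate (k g : C_c(G, ℂ)) :
    HasCompactSupport fun t => ccToLp μ r (mulTranslate k g t) :=
  HasCompactSupport.intro (isCompact_inv_mul_tsupport k.hasCompactSupport g) fun t ht => by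
    rw [mulTranslate_eq_zero (fun z hz => subset_tsupport _ hz) ht, map_zero]

/-- By uniform continuity, moving `t` changes `g (z * t)` by at most `δ` uniformly in `z`, and the
factor `k` turns this into an `L^r` bound `δ ‖k‖_r`. -/
theorem continuous_ccToLp_mulTranslate [Fact (1 ≤ r)] (k g : C_c(G, ℂ)) :
    Continuous fun t => ccToLp μ r (mulTranslate k g t) := by
  rw [continuous_iff_continuousAt]
  intro t₀
  rw [ContinuousAt, tendsto_iff_norm_sub_tendsto_zero, NormedAddGroup.tendsto_nhds_zero]
  intro ε hε
  obtain ⟨δ, hδ, hδε⟩ : ∃ δ > 0, δ * ‖ccToLp μ r k‖ < ε :=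
    ⟨ε / (‖ccToLp μ r k‖ + 1), by positivity, by
      rw [div_mul_eq_mul_div, div_lt_iff₀ (by positivity)]
      nlinarith [norm_nonneg (ccToLp μ r k)]⟩
  have h1 : Tendsto (fun t => t₀⁻¹ * t) (𝓝 t₀) (𝓝 1) := by
    have : Continuous fun t => t₀⁻¹ * t := by fun_prop
    simpa using this.tendsto t₀
  filter_upwards [h1.eventually (eventually_norm_right_mul_sub_le g hδ)] with t ht
  rw [norm_norm, ← map_sub]
  refine (norm_ccToLp_le_mul fun z => ?_).trans_lt hδε
  have := ht (z * t₀)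
  rw [mul_assoc, mul_inv_cancel_left] at this
  rw [CompactlySupportedContinuousMap.sub_apply, mulTranslate_apply, mulTranslate_apply, ← mul_sub,
    norm_mul, mul_comm]
  gcongr

theorem integral_norm_mulTranslate_rpow (hr0 : r ≠ 0) (hr : r ≠ ∞) (k g : C_c(G, ℂ)) :
    ∫ t, ‖ccToLp μ r (mulTranslate k g t)‖ ^ r.toReal ∂μ =
      ‖ccToLp μ r k‖ ^ r.toReal * ‖ccToLp μ r g‖ ^ r.toReal := by
  have hr' := ENNReal.toReal_pos hr0 hr
  simp_rw [norm_ccToLp_rpow hr0 hr]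
  -- The Haar measure need not be σ-finite, so Fubini is used for continuous functions with compact
  -- support in the product.
  rw [integral_integral_swap_of_hasCompactSupport]
  · have : ∀ z, ∫ t, ‖mulTranslate k g t z‖ ^ r.toReal ∂μ =
        ‖k z‖ ^ r.toReal * ∫ t, ‖g t‖ ^ r.toReal ∂μ := by
      intro z
      simp only [mulTranslate_apply, norm_mul]
      simp_rw [Real.mul_rpow (norm_nonneg _) (norm_nonneg _)]
      rw [integral_const_mul, integral_mul_left_eq_self (fun t => ‖g t‖ ^ r.toReal)]
    simp_rw [this]
    rw [integral_mul_const]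
  · simp only [Function.uncurry_def, mulTranslate_apply]
    refine Continuous.rpow_const (by fun_prop) fun _ => .inr hr'.le
  · have hK := (isCompact_inv_mul_tsupport k.hasCompactSupport g).prod
      k.hasCompactSupport
    refine HasCompactSupport.intro hK fun x hx => ?_
    by_contra h
    have h' : k x.2 * g (x.2 * x.1) ≠ 0 := by
      intro h0
      apply h
      simp only [Function.uncurry_def, mulTranslate_apply, h0, norm_zero, Real.zero_rpow hr'.ne']
    refine hx ⟨mem_of_mul_translate_ne_zero (fun z hz => subset_tsupport _ hz) h',
      subset_tsupport _ (left_ne_zero_of_mul h')⟩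

/-! ### The product formula in `A_p(G)`. -/

variable {p : ℝ≥0∞} [Fact (1 ≤ p)]

/-- The integrand in the formula for the product `(g * f^∨) (k * h^∨)`. -/
def prodIntegrand (μ : Measure G) [μ.IsHaarMeasure] (p : ℝ≥0∞) [Fact (1 ≤ p)]
    (k h g f : C_c(G, ℂ)) (t : G) : Ap μ p :=
  herzPairing μ p (ccToLp μ _ (mulTranslate k g t)) (ccToLp μ _ (mulTranslate h f t))

theorem continuous_prodIntegrand (k h g f : C_c(G, ℂ)) :
    Continuous (prodIntegrand μ p k h g f) :=
  (herzPairing μ p).continuous₂.comp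
    ((continuous_ccToLp_mulTranslate k g).prodMk (continuous_ccToLp_mulTranslate h f))

theorem hasCompactSupport_prodIntegrand (k h g f : C_c(G, ℂ)) :
    HasCompactSupport (prodIntegrand μ p k h g f) :=
  (hasCompactSupport_ccToLp_mulTranslate (μ := μ) (r := p.conjExponent) k g).mono' fun t ht => by
    refine subset_tsupport _ fun h0 => ht ?_
    simp only [prodIntegrand, h0, map_zero, zero_apply]

theorem integrable_prodIntegrand (k h g f : C_c(G, ℂ)) :
    Integrable (prodIntegrand μ p k h g f) μ :=
  (continuous_prodIntegrand k h g f).integrable_of_hasCompactSupport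
    (hasCompactSupport_prodIntegrand k h g f)

theorem toFun_herzPairing_cc (g f : C_c(G, ℂ)) (x : G) :
    Ap.toFun (herzPairing μ p (ccToLp μ _ g) (ccToLp μ _ f)) x = ∫ y, g y * f (x⁻¹ * y) ∂μ := by
  rw [toFun_herzPairing_of_ae_eq (coeFn_ccToLp _ _ _) (coeFn_ccToLp _ _ _)]
  simp [conv, check]

/-- At `x` the left side is the double integral of `k(z) g(z t) h(x⁻¹ z) f(x⁻¹ z t)`. For fixed `z`,
the substitution `t ↦ z⁻¹ t` separates the variables. -/
theorem toFun_integral_prodIntegrand (k h g f : C_c(G, ℂ)) (x : G) :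
    Ap.toFun (∫ t, prodIntegrand μ p k h g f t ∂μ) x =
      Ap.toFun (herzPairing μ p (ccToLp μ _ k) (ccToLp μ _ h)) x *
        Ap.toFun (herzPairing μ p (ccToLp μ _ g) (ccToLp μ _ f)) x := by
  rw [← Ap.evalCLM_apply, ← ContinuousLinearMap.integral_comp_comm _
    (integrable_prodIntegrand k h g f)]
  simp only [Ap.evalCLM_apply, prodIntegrand, toFun_herzPairing_cc]
  rw [integral_integral_swap_of_hasCompactSupport]
  · have : ∀ z, ∫ t, mulTranslate k g t z * mulTranslate h f t (x⁻¹ * z) ∂μ =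
        k z * h (x⁻¹ * z) * ∫ t, g t * f (x⁻¹ * t) ∂μ := by
      intro z
      rw [← integral_mul_left_eq_self (fun t => g t * f (x⁻¹ * t)) z, ← integral_const_mul]
      refine integral_congr_ae (.of_forall fun t => ?_)
      simp only [mulTranslate_apply, mul_assoc]
      ring
    simp_rw [this]
    rw [integral_mul_const]
  · simp only [Function.uncurry_def, mulTranslate_apply]
    fun_prop
  · have hK := (isCompact_inv_mul_tsupport k.hasCompactSupport g).prod
      k.hasCompactSupport
    refine HasCompactSupport.intro hK fun y hy => ?_
    by_contra h
    have h' : k y.2 * g (y.2 * y.1) ≠ 0 := left_ne_zero_of_mul h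
    exact hy ⟨mem_of_mul_translate_ne_zero (fun z hz => subset_tsupport _ hz) h',
      subset_tsupport _ (left_ne_zero_of_mul h')⟩

/-- The integrand has norm at most `‖k g(· t)‖_q ‖h f(· t)‖_p`. Hölder in `t` then leaves two
factors which `integral_norm_mulTranslate_rpow` evaluates as `‖k‖_q ‖g‖_q` and `‖h‖_p ‖f‖_p`. -/
theorem norm_integral_prodIntegrand_le (hp1 : 1 < p) (hp : p ≠ ∞) (hq : p.conjExponent ≠ ∞)
    (k h g f : C_c(G, ℂ)) :
    ‖∫ t, prodIntegrand μ p k h g f t ∂μ‖ ≤ ‖ccToLp μ p.conjExponent k‖ * ‖ccToLp μ p h‖ *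
      (‖ccToLp μ p.conjExponent g‖ * ‖ccToLp μ p f‖) := by
  have hp0 : p ≠ 0 := (zero_lt_one.trans hp1).ne'
  have hq0 : p.conjExponent ≠ 0 := ENNReal.HolderConjugate.ne_zero p.conjExponent p
  have hp0' := ENNReal.toReal_pos hp0 hp
  have hq0' := ENNReal.toReal_pos hq0 hq
  have hconj : p.toReal.HolderConjugate p.conjExponent.toReal :=
    ENNReal.HolderConjugate.toReal (by
      rw [← ENNReal.toReal_one]; exact (ENNReal.toReal_lt_toReal (by simp) hp).2 hp1)
  have hAc := (continuous_ccToLp_mulTranslate (μ := μ) (r := p.conjExponent) k g).norm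
  have hBc := (continuous_ccToLp_mulTranslate (μ := μ) (r := p) h f).norm
  have hAs := (hasCompactSupport_ccToLp_mulTranslate (μ := μ) (r := p.conjExponent) k g).norm
  have hBs := (hasCompactSupport_ccToLp_mulTranslate (μ := μ) (r := p) h f).norm
  have h1 : ‖∫ t, prodIntegrand μ p k h g f t ∂μ‖ ≤
      ∫ t, ‖ccToLp μ p.conjExponent (mulTranslate k g t)‖ * ‖ccToLp μ p (mulTranslate h f t)‖ ∂μ :=
    norm_integral_le_of_norm_le ((hAc.mul hBc).integrable_of_hasCompactSupport hAs.mul_right)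
      (.of_forall fun t => norm_herzPairing_le _ _)
  have h2 := integral_mul_le_Lp_mul_Lq_of_nonneg (μ := μ) hconj.symm
    (.of_forall fun t => norm_nonneg _) (.of_forall fun t => norm_nonneg _)
    (hAc.memLp_of_hasCompactSupport hAs) (hBc.memLp_of_hasCompactSupport hBs)
  have h3 : ∀ a b s : ℝ, 0 ≤ a → 0 ≤ b → 0 < s → (a ^ s * b ^ s) ^ (1 / s) = a * b := by
    intro a b s ha hb hs
    rw [← Real.mul_rpow ha hb, one_div, Real.rpow_rpow_inv (by positivity) hs.ne']
  rw [integral_norm_mulTranslate_rpow hq0 hq, integral_norm_mulTranslate_rpow hp0 hp,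
    h3 _ _ _ (norm_nonneg _) (norm_nonneg _) hq0', h3 _ _ _ (norm_nonneg _) (norm_nonneg _) hp0',
    mul_mul_mul_comm] at h2
  exact h1.trans h2

end Translation

/-! ### `A_p(G)` as a normed algebra, and its continuous elements in `B_p(G)`. -/

section Bumps

variable {G : Type*} [Group G] [TopologicalSpace G] [IsTopologicalGroup G]
  [LocallyCompactSpace G] [MeasurableSpace G] [BorelSpace G] {μ : Measure G} [μ.IsHaarMeasure]
  {p : ℝ≥0∞} [Fact (1 ≤ p)]

theorem conjExponent_ne_top {p : ℝ≥0∞} (hp1 : 1 < p) : p.conjExponent ≠ ∞ := by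
  simp [ENNReal.conjExponent, tsub_eq_zero_iff_le, hp1]

/-- `A_p(G)` is closed under pointwise multiplication and its norm is submultiplicative. -/
theorem herzENorm_mul_le [μ.Regular] (hp1 : 1 < p) (hp : p ≠ ∞) (a b : Ap μ p) :
    herzENorm μ p (fun x => Ap.toFun a x * Ap.toFun b x) ≤ ENNReal.ofReal (‖a‖ * ‖b‖) := by
  have hq := conjExponent_ne_top hp1
  have hsub : ∀ (c : Ap μ p) (v : ℕ → Ap μ p) (u : Ap μ p), HasSum v u →
      herzENorm μ p (fun x => Ap.toFun c x * Ap.toFun u x) ≤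
        ∑' n, herzENorm μ p (fun x => Ap.toFun c x * Ap.toFun (v n) x) := fun c v u hu =>
    herzENorm_le_tsum μ p _ _ fun x => (hu.mapL (Ap.evalCLM μ p x)).mul_left _
  have h1 : ∀ k h g f : C_c(G, ℂ), herzENorm μ p (fun x =>
      Ap.toFun (herzPairing μ p (ccToLp μ _ k) (ccToLp μ _ h)) x *
        Ap.toFun (herzPairing μ p (ccToLp μ _ g) (ccToLp μ _ f)) x) ≤
      ENNReal.ofReal (‖ccToLp μ p.conjExponent k‖ * ‖ccToLp μ p h‖ *
        ‖ccToLp μ p.conjExponent g‖ * ‖ccToLp μ p f‖) := by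
    intro k h g f
    rw [← funext (toFun_integral_prodIntegrand (μ := μ) (p := p) k h g f), ← Ap.ofReal_norm,
      mul_assoc]
    exact ENNReal.ofReal_le_ofReal (norm_integral_prodIntegrand_le hp1 hp hq k h g f)
  -- One factor is made arbitrary while the other is still `k * h^∨`; the last line does the same
  -- for the second factor.
  have h2 : ∀ k h : C_c(G, ℂ), herzENorm μ p (fun x =>
      Ap.toFun a x * Ap.toFun (herzPairing μ p (ccToLp μ _ k) (ccToLp μ _ h)) x) ≤
      ENNReal.ofReal (‖a‖ * ‖ccToLp μ p.conjExponent k‖ * ‖ccToLp μ p h‖) := by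
    intro k h
    have := Ap.le_of_cc_of_tsum_le hp hq (N := fun u => herzENorm μ p (fun x =>
      Ap.toFun (herzPairing μ p (ccToLp μ _ k) (ccToLp μ _ h)) x * Ap.toFun u x))
      (by positivity) (hsub _) (h1 k h) a
    simp_rw [mul_comm (Ap.toFun a _)]
    rwa [mul_assoc, mul_comm ‖a‖]
  exact Ap.le_of_cc_of_tsum_le hp hq (norm_nonneg a) (hsub a) h2 b

namespace Bp

/-- The multiplier norm is dominated by the norm of `A_p(G)`. -/
theorem norm_le_of_toFun_eq [μ.Regular] (hp1 : 1 < p) (hp : p ≠ ∞) {a : Ap μ p} {b : Bp μ p}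
    (h : ∀ x, Ap.toFun a x = toBCF b x) : ‖b‖ ≤ ‖a‖ := by
  rw [norm_def, multNorm_eq]
  refine ContinuousLinearMap.opNorm_le_bound _ (norm_nonneg a) fun v => ?_
  have h1 := herzENorm_mul_le hp1 hp a v
  simp_rw [h, ← toFun_mult] at h1
  rw [← Ap.ofReal_norm] at h1
  exact (ENNReal.ofReal_le_ofReal_iff (by positivity)).1 h1

theorem continuous_toFun_herzPairing_cc (k h : C_c(G, ℂ)) :
    Continuous (Ap.toFun (herzPairing μ p (ccToLp μ _ k) (ccToLp μ _ h))) := by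
  rw [funext (toFun_herzPairing_cc (μ := μ) (p := p) k h), ← continuousOn_univ]
  refine continuousOn_integral_of_compact_support k.hasCompactSupport ?_ fun x y _ hy => ?_
  · exact Continuous.continuousOn (by fun_prop)
  · rw [image_eq_zero_of_notMem_tsupport hy, zero_mul]

/-- A continuous element of `A_p(G)`, as an element of `B_p(G)`. -/
def ofAp [μ.Regular] (hp1 : 1 < p) (hp : p ≠ ∞) (a : Ap μ p) (ha : Continuous (Ap.toFun a)) :
    Bp μ p :=
  ⟨BoundedContinuousFunction.ofNormedAddCommGroup (Ap.toFun a) ha _ (Ap.norm_apply_le a),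
    fun v hv => by
      let w : Ap μ p := ⟨v, hv⟩
      exact herzENorm_lt_top_iff.1 ((herzENorm_mul_le hp1 hp a w).trans_lt ENNReal.ofReal_lt_top)⟩

variable (μ) in
/-- The function `k * h^∨` as an element of `B_p(G)`. -/
def ofPairing [μ.Regular] (hp1 : 1 < p) (hp : p ≠ ∞) (x : C_c(G, ℂ) × C_c(G, ℂ)) : Bp μ p :=
  ofAp hp1 hp (herzPairing μ p (ccToLp μ _ x.1) (ccToLp μ _ x.2))
    (continuous_toFun_herzPairing_cc x.1 x.2)

theorem toBCF_ofPairing [μ.Regular] (hp1 : 1 < p) (hp : p ≠ ∞) (x : C_c(G, ℂ) × C_c(G, ℂ))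
    (y : G) : toBCF (ofPairing μ hp1 hp x) y =
      Ap.toFun (herzPairing μ p (ccToLp μ _ x.1) (ccToLp μ _ x.2)) y := rfl

end Bp

/-! ### Normalized functions with supports shrinking to the identity. -/

variable (μ p) in
/-- The normalized pairs of functions supported in a set `V`. -/
def bumpPairs (V : Set G) : Set (C_c(G, ℂ) × C_c(G, ℂ)) :=
  {x | (∀ z, x.1 z ≠ 0 → z ∈ V) ∧ (∀ z, x.2 z ≠ 0 → z ∈ V) ∧
    ‖ccToLp μ p.conjExponent x.1‖ = 1 ∧ ‖ccToLp μ p x.2‖ = 1 ∧ ∫ z, x.1 z * x.2 z ∂μ = 1}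

theorem monotone_bumpPairs : Monotone (bumpPairs μ p : Set G → _) :=
  fun _ _ hVW _ hx => ⟨fun z hz => hVW (hx.1 z hz), fun z hz => hVW (hx.2.1 z hz), hx.2.2⟩

/-- Take `ψ ≥ 0` vanishing off `V` with integral `1`. The pair `(ψ^{1/q}, ψ^{1/p})` is the equality
case of Hölder's inequality. -/
theorem bumpPairs_nonempty (hp1 : 1 < p) (hp : p ≠ ∞) {V : Set G} (hV : V ∈ 𝓝 1) :
    (bumpPairs μ p V).Nonempty := by
  have hq := conjExponent_ne_top hp1
  have hp0 : p ≠ 0 := (zero_lt_one.trans hp1).ne'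
  have hq0 : p.conjExponent ≠ 0 := ENNReal.HolderConjugate.ne_zero p.conjExponent p
  have hp0' := ENNReal.toReal_pos hp0 hp
  have hq0' := ENNReal.toReal_pos hq0 hq
  have hconj : p.toReal.HolderConjugate p.conjExponent.toReal :=
    ENNReal.HolderConjugate.toReal (by
      rw [← ENNReal.toReal_one]; exact (ENNReal.toReal_lt_toReal (by simp) hp).2 hp1)
  obtain ⟨φ, hφ1, hφV, hφc, hφ⟩ := exists_continuous_one_zero_of_isCompact
    (isCompact_singleton (x := (1 : G))) (isOpen_interior (s := V)).isClosed_compl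
    (Set.disjoint_compl_right_iff_subset.2 (Set.singleton_subset_iff.2 (mem_interior_iff_mem_nhds.2 hV)))
  have hI : 0 < ∫ z, φ z ∂μ := φ.continuous.integral_pos_of_hasCompactSupport_nonneg_nonzero
    hφc (fun x => (hφ x).1) (x := 1) (by simp [hφ1 rfl])
  set I := ∫ z, φ z ∂μ
  let ψ : G → ℝ := fun z => I⁻¹ * φ z
  have hψc : Continuous ψ := continuous_const.mul φ.continuous
  have hψ0 : ∀ z, 0 ≤ ψ z := fun z => mul_nonneg (inv_nonneg.2 hI.le) (hφ z).1
  have hψs : HasCompactSupport ψ := hφc.mul_left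
  have hψI : ∫ z, ψ z ∂μ = 1 := by
    simp only [ψ]
    rw [integral_const_mul]
    exact inv_mul_cancel₀ hI.ne'
  have hψV : ∀ z, ψ z ≠ 0 → z ∈ V := fun z hz => by
    by_contra hzV
    exact hz (by simp [ψ, hφV (show z ∈ (interior V)ᶜ from fun h => hzV (interior_subset h))])
  let root : ∀ s : ℝ, 0 < s → C_c(G, ℂ) := fun s hs =>
    { toFun := fun z => ((ψ z ^ s⁻¹ : ℝ) : ℂ)
      continuous_toFun := Complex.continuous_ofReal.comp
        (hψc.rpow_const fun _ => .inr (inv_nonneg.2 hs.le))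
      hasCompactSupport' := hψs.comp_left (g := fun y : ℝ => ((y ^ s⁻¹ : ℝ) : ℂ))
        (by simp [Real.zero_rpow (inv_ne_zero hs.ne')]) }
  have hroot : ∀ s hs z, root s hs z = ((ψ z ^ s⁻¹ : ℝ) : ℂ) := fun _ _ _ => rfl
  have hrootV : ∀ s hs z, root s hs z ≠ 0 → z ∈ V := fun s hs z hz => hψV z fun h => hz (by
    rw [hroot s hs, h, Real.zero_rpow (inv_ne_zero hs.ne'), Complex.ofReal_zero])
  have hnorm : ∀ r : ℝ≥0∞, r ≠ 0 → r ≠ ∞ → ∀ hs, ‖ccToLp μ r (root r.toReal hs)‖ = 1 := by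
    intro r hr0 hr hs
    rw [norm_ccToLp_eq hr0 hr]
    have : ∀ z, ‖root r.toReal hs z‖ ^ r.toReal = ψ z := fun z => by
      rw [hroot _ hs, Complex.norm_real, Real.norm_of_nonneg (Real.rpow_nonneg (hψ0 z) _),
        Real.rpow_inv_rpow (hψ0 z) hs.ne']
    simp_rw [this, hψI, Real.one_rpow]
  refine ⟨(root p.conjExponent.toReal hq0', root p.toReal hp0'), hrootV _ hq0', hrootV _ hp0', hnorm _ hq0 hq hq0',
    hnorm _ hp0 hp hp0', ?_⟩
  have : ∀ z, root p.conjExponent.toReal hq0' z * root p.toReal hp0' z = ((ψ z : ℝ) : ℂ) := fun z => by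
    -- Since `ψ z` may vanish, adding the exponents requires that their sum be nonzero; it is `1`.
    rw [hroot _ hq0', hroot _ hp0', ← Complex.ofReal_mul, ← Real.rpow_add' (hψ0 z)]
    · rw [add_comm, hconj.inv_add_inv_eq_one, Real.rpow_one]
    · rw [add_comm, hconj.inv_add_inv_eq_one]; exact one_ne_zero
  simp_rw [this]
  rw [integral_complex_ofReal, hψI, Complex.ofReal_one]

variable (μ p) in
/-- The filter of normalized pairs whose support shrinks to the identity. -/
def bumpFilter : Filter (C_c(G, ℂ) × C_c(G, ℂ)) := (𝓝 1).lift' (bumpPairs μ p)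

theorem bumpFilter_neBot (hp1 : 1 < p) (hp : p ≠ ∞) :
    (bumpFilter μ p : Filter (C_c(G, ℂ) × _)).NeBot :=
  (lift'_neBot_iff monotone_bumpPairs).2 fun _ hV => bumpPairs_nonempty hp1 hp hV

theorem eventually_bumpFilter {V : Set G} (hV : V ∈ 𝓝 1) :
    ∀ᶠ x in bumpFilter μ p, x ∈ bumpPairs μ p V :=
  mem_lift' hV

/-! ### Asymptotics of products with the normalized functions. -/

theorem norm_prodIntegrand_sub_le {V : Set G} {x : C_c(G, ℂ) × C_c(G, ℂ)}
    (hx : x ∈ bumpPairs μ p V) {g f : C_c(G, ℂ)} {Mg Mf δ : ℝ} (hδ : 0 ≤ δ)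
    (hMg : ∀ z, ‖g z‖ ≤ Mg) (hMf : ∀ z, ‖f z‖ ≤ Mf)
    (hg : ∀ z ∈ V, ∀ t, ‖g (z * t) - g t‖ ≤ δ) (hf : ∀ z ∈ V, ∀ t, ‖f (z * t) - f t‖ ≤ δ) (t : G) :
    ‖prodIntegrand μ p x.1 x.2 g f t -
      (g t * f t) • herzPairing μ p (ccToLp μ _ x.1) (ccToLp μ _ x.2)‖ ≤ δ * (Mf + Mg) := by
  obtain ⟨hk, hh, hk1, hh1, -⟩ := hx
  -- On the support of `k` the factor `u (z * t)` is within `δ` of the constant `u t`.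
  have key : ∀ (r : ℝ≥0∞) (k u : C_c(G, ℂ)), (∀ z, k z ≠ 0 → z ∈ V) →
      (∀ z ∈ V, ∀ t, ‖u (z * t) - u t‖ ≤ δ) →
      ‖ccToLp μ r (mulTranslate k u t) - u t • ccToLp μ r k‖ ≤ δ * ‖ccToLp μ r k‖ := by
    intro r k u hk hu
    rw [← map_smul, ← map_sub]
    refine norm_ccToLp_le_mul fun z => ?_
    rw [CompactlySupportedContinuousMap.sub_apply, CompactlySupportedContinuousMap.smul_apply,
      mulTranslate_apply, smul_eq_mul, mul_comm (u t), ← mul_sub, norm_mul, mul_comm]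
    rcases eq_or_ne (k z) 0 with h0 | h0
    · simp [h0]
    · exact mul_le_mul_of_nonneg_right (hu z (hk z h0) t) (norm_nonneg _)
  have h1 := key p.conjExponent x.1 g hk hg
  have h2 := key p x.2 f hh hf
  have h3 : ‖ccToLp μ p (mulTranslate x.2 f t)‖ ≤ Mf := by
    have : ‖ccToLp μ p (mulTranslate x.2 f t)‖ ≤ Mf * ‖ccToLp μ p x.2‖ :=
      norm_ccToLp_le_mul fun z => by
        rw [mulTranslate_apply, norm_mul, mul_comm]
        exact mul_le_mul_of_nonneg_right (hMf _) (norm_nonneg _)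
    rwa [hh1, mul_one] at this
  have h4 : ‖g t • ccToLp μ p.conjExponent x.1‖ ≤ Mg := by
    rw [norm_smul, hk1, mul_one]; exact hMg t
  rw [hk1, mul_one] at h1
  rw [hh1, mul_one] at h2
  have h5 : prodIntegrand μ p x.1 x.2 g f t -
      (g t * f t) • herzPairing μ p (ccToLp μ _ x.1) (ccToLp μ _ x.2) =
      herzPairing μ p (ccToLp μ _ (mulTranslate x.1 g t) - g t • ccToLp μ _ x.1)
        (ccToLp μ _ (mulTranslate x.2 f t)) +
      herzPairing μ p (g t • ccToLp μ _ x.1)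
        (ccToLp μ _ (mulTranslate x.2 f t) - f t • ccToLp μ _ x.2) := by
    simp only [prodIntegrand, map_sub, map_smul, sub_apply, smul_apply, smul_smul, mul_comm (g t)]
    abel
  rw [h5, mul_add, mul_comm δ Mg]
  refine (norm_add_le _ _).trans (add_le_add ((norm_herzPairing_le _ _).trans ?_)
    ((norm_herzPairing_le _ _).trans ?_))
  · exact mul_le_mul h1 h3 (norm_nonneg _) hδ
  · exact mul_le_mul h4 h2 (norm_nonneg _) ((norm_nonneg _).trans h4)

/-- The pointwise bound is integrated over the compact set `L`, which contains the supports of all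
integrands once `k` is supported in `K`. Its finite measure makes the estimate uniform. -/
theorem tendsto_integral_prodIntegrand_sub (g f : C_c(G, ℂ)) :
    Tendsto (fun x : C_c(G, ℂ) × C_c(G, ℂ) => (∫ t, prodIntegrand μ p x.1 x.2 g f t ∂μ) -
      (∫ t, g t * f t ∂μ) • herzPairing μ p (ccToLp μ _ x.1) (ccToLp μ _ x.2))
      (bumpFilter μ p) (𝓝 0) := by
  obtain ⟨Mg, hMg0, hMg⟩ := exists_norm_le_cc g
  obtain ⟨Mf, hMf0, hMf⟩ := exists_norm_le_cc f
  obtain ⟨K, hK, hK1⟩ := exists_compact_mem_nhds (1 : G)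
  have hL := isCompact_inv_mul_tsupport hK g
  set L := K⁻¹ * tsupport g
  rw [NormedAddGroup.tendsto_nhds_zero]
  intro ε hε
  obtain ⟨δ, hδ, hδε⟩ : ∃ δ > 0, δ * (Mf + Mg) * μ.real L < ε := by
    have h0 : 0 ≤ μ.real L := measureReal_nonneg
    refine ⟨ε / ((Mf + Mg) * μ.real L + 1), by positivity, ?_⟩
    rw [mul_assoc, div_mul_eq_mul_div, div_lt_iff₀ (by positivity)]
    nlinarith
  filter_upwards [eventually_bumpFilter (inter_mem hK1 (inter_mem
    (eventually_norm_left_mul_sub_le g hδ) (eventually_norm_left_mul_sub_le f hδ)))] with x hx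
  have hgf : Integrable (fun t => g t * f t) μ :=
    ((map_continuous g).mul (map_continuous f)).integrable_of_hasCompactSupport
      g.hasCompactSupport.mul_right
  rw [← integral_smul_const, ← integral_sub (integrable_prodIntegrand _ _ _ _)
    (hgf.smul_const _), ← setIntegral_eq_integral_of_forall_compl_eq_zero (s := L)]
  · refine lt_of_le_of_lt (norm_setIntegral_le_of_norm_le_const hL.measure_lt_top fun t _ =>
      norm_prodIntegrand_sub_le hx hδ.le hMg hMf (fun z hz => hz.2.1) (fun z hz => hz.2.2) t) hδε
  · intro t ht
    have h1 : g t = 0 := by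
      by_contra h0
      exact ht ⟨1, by simpa using mem_of_mem_nhds hK1, t, subset_tsupport _ h0, by simp⟩
    have h2 : mulTranslate x.1 g t = 0 := mulTranslate_eq_zero (fun z hz => (hx.1 z hz).1) ht
    simp [prodIntegrand, h1, h2]

theorem Bp.mult_ofPairing_herzPairing [μ.Regular] (hp1 : 1 < p) (hp : p ≠ ∞)
    (x : C_c(G, ℂ) × C_c(G, ℂ)) (g f : C_c(G, ℂ)) :
    Bp.mult (Bp.ofPairing μ hp1 hp x) (herzPairing μ p (ccToLp μ _ g) (ccToLp μ _ f)) =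
      ∫ t, prodIntegrand μ p x.1 x.2 g f t ∂μ :=
  Ap.toFun_injective <| funext fun y => by
    rw [Bp.toFun_mult, Bp.toBCF_ofPairing, toFun_integral_prodIntegrand]

theorem Bp.norm_ofPairing_le [μ.Regular] (hp1 : 1 < p) (hp : p ≠ ∞)
    (x : C_c(G, ℂ) × C_c(G, ℂ)) :
    ‖Bp.ofPairing μ hp1 hp x‖ ≤ ‖ccToLp μ p.conjExponent x.1‖ * ‖ccToLp μ p x.2‖ :=
  (Bp.norm_le_of_toFun_eq hp1 hp fun _ => rfl).trans (norm_herzPairing_le _ _)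

/-- For `a ∈ A_p(G)`, the products `a w` with the normalized functions `w` whose supports shrink to
the identity are asymptotic to `a(e) w`. -/
theorem tendsto_mult_ofPairing_sub [μ.Regular] (hp1 : 1 < p) (hp : p ≠ ∞) (a : Ap μ p) :
    Tendsto (fun x : C_c(G, ℂ) × C_c(G, ℂ) => Bp.mult (Bp.ofPairing μ hp1 hp x) a -
      Ap.toFun a 1 • herzPairing μ p (ccToLp μ _ x.1) (ccToLp μ _ x.2))
      (bumpFilter μ p) (𝓝 0) := by
  let T : C_c(G, ℂ) × C_c(G, ℂ) → Ap μ p →ₗ[ℂ] Ap μ p := fun x =>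
    (Bp.mult (Bp.ofPairing μ hp1 hp x)).toLinearMap - (Ap.evalCLM μ p 1).toLinearMap.smulRight
      (herzPairing μ p (ccToLp μ _ x.1) (ccToLp μ _ x.2))
  -- The uniform bound makes the subspace `Z` of those `b` with `T x b → 0` closed, so the
  -- generators `g * f^∨` with `g, f` compactly supported suffice.
  have hT : ∀ᶠ x in bumpFilter μ p, ∀ b, ‖T x b‖ ≤ 2 * ‖b‖ := by
    filter_upwards [eventually_bumpFilter univ_mem] with x hx b
    obtain ⟨-, -, hk, hh, -⟩ := hx
    have h1 : ‖Bp.mult (Bp.ofPairing μ hp1 hp x) b‖ ≤ 1 * ‖b‖ := by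
      refine (Bp.mult _).le_of_opNorm_le ?_ b
      rw [← Bp.multNorm_eq, ← Bp.norm_def]
      simpa [hk, hh] using Bp.norm_ofPairing_le (μ := μ) hp1 hp x
    have h2 : ‖Ap.toFun b 1 • herzPairing μ p (ccToLp μ _ x.1) (ccToLp μ _ x.2)‖ ≤ ‖b‖ * 1 := by
      rw [norm_smul]
      have := norm_herzPairing_le (ccToLp μ p.conjExponent x.1) (ccToLp μ p x.2)
      rw [hk, hh, mul_one] at this
      exact mul_le_mul (Ap.norm_apply_le b 1) this (norm_nonneg _) (norm_nonneg _)
    have h3 : T x b = Bp.mult (Bp.ofPairing μ hp1 hp x) b -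
      Ap.toFun b 1 • herzPairing μ p (ccToLp μ _ x.1) (ccToLp μ _ x.2) := rfl
    rw [h3]
    exact (norm_sub_le _ _).trans (by linarith)
  let Z : Submodule ℂ (Ap μ p) :=
    { carrier := {b | Tendsto (fun x => T x b) (bumpFilter μ p) (𝓝 0)}
      zero_mem' := tendsto_const_nhds.congr fun x => (map_zero (T x)).symm
      add_mem' := fun {b c} hb hc => by
        simpa only [Set.mem_ofPred_eq, map_add, add_zero] using Tendsto.add hb hc
      smul_mem' := fun c b hb => by
        simpa only [Set.mem_ofPred_eq, map_smul, smul_zero] using Tendsto.const_smul hb c }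
  have hZ : ∀ b ∈ Z.topologicalClosure, b ∈ Z := by
    intro b hb
    change Tendsto _ _ _
    rw [NormedAddGroup.tendsto_nhds_zero]
    intro ε hε
    obtain ⟨c, hc, hbc⟩ := Metric.mem_closure_iff.1 hb (ε / 4) (by positivity)
    filter_upwards [hT, NormedAddGroup.tendsto_nhds_zero.1 hc (ε / 2) (by positivity)]
      with x hx hxc
    have h1 := hx (b - c)
    rw [map_sub] at h1
    rw [dist_eq_norm] at hbc
    have := norm_add_le (T x b - T x c) (T x c)
    rw [sub_add_cancel] at this
    linarith
  refine hZ a (Submodule.topologicalClosure_mono (Submodule.span_le.2 ?_)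
    (Ap.mem_closure_span_cc hp (conjExponent_ne_top hp1) a))
  rintro _ ⟨⟨g, f⟩, rfl⟩
  refine (tendsto_integral_prodIntegrand_sub g f).congr fun x => ?_
  have h3 : T x (herzPairing μ p (ccToLp μ _ g) (ccToLp μ _ f)) =
    Bp.mult (Bp.ofPairing μ hp1 hp x) (herzPairing μ p (ccToLp μ _ g) (ccToLp μ _ f)) -
      Ap.toFun (herzPairing μ p (ccToLp μ _ g) (ccToLp μ _ f)) 1 •
        herzPairing μ p (ccToLp μ _ x.1) (ccToLp μ _ x.2) := rfl
  -- The coefficient matches because `(g * f^∨)(e) = ∫ g f`.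
  rw [h3, Bp.mult_ofPairing_herzPairing, toFun_herzPairing_cc]
  simp

namespace Bp

theorem eventually_norm_ofPairing_le_one [μ.Regular] (hp1 : 1 < p) (hp : p ≠ ∞) :
    ∀ᶠ x in bumpFilter μ p, ‖ofPairing μ hp1 hp x‖ ≤ 1 := by
  filter_upwards [eventually_bumpFilter univ_mem] with x hx
  simpa [hx.2.2.1, hx.2.2.2.1] using norm_ofPairing_le (μ := μ) hp1 hp x

theorem ofPairing_apply_one [μ.Regular] (hp1 : 1 < p) (hp : p ≠ ∞) {V : Set G}
    {x : C_c(G, ℂ) × C_c(G, ℂ)} (hx : x ∈ bumpPairs μ p V) :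
    toBCF (ofPairing μ hp1 hp x) 1 = 1 := by
  rw [toBCF_ofPairing, toFun_herzPairing_cc]
  simpa using hx.2.2.2.2

theorem eventually_ofPairing_apply_one [μ.Regular] (hp1 : 1 < p) (hp : p ≠ ∞) :
    ∀ᶠ x in bumpFilter μ p, toBCF (ofPairing μ hp1 hp x) 1 = 1 := by
  filter_upwards [eventually_bumpFilter univ_mem] with x hx
  exact ofPairing_apply_one hp1 hp hx

/-- The normalized functions `w` whose supports shrink to the identity satisfy
`‖u w - u(e) w‖ → 0` for all `u ∈ B_p(G)`. -/
theorem tendsto_mul_ofPairing_sub [μ.Regular] (hp1 : 1 < p) (hp : p ≠ ∞) (u : Bp μ p) :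
    Tendsto (fun x => u * ofPairing μ hp1 hp x - toBCF u 1 • ofPairing μ hp1 hp x)
      (bumpFilter μ p) (𝓝 0) := by
  -- A fixed `w₀ ∈ A_p(G)` with `w₀(e) = 1` brings `u` into `A_p(G)`: the value of `u w₀` at `e` is
  -- still `u(e)`.
  obtain ⟨x₀, hx₀⟩ := bumpPairs_nonempty (μ := μ) hp1 hp (univ_mem (f := 𝓝 (1 : G)))
  set w₀ := ofPairing μ hp1 hp x₀
  have key : ∀ u : Bp μ p, Tendsto (fun x => u * w₀ * ofPairing μ hp1 hp x -
      toBCF u 1 • ofPairing μ hp1 hp x) (bumpFilter μ p) (𝓝 0) := by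
    intro u
    have h := tendsto_mult_ofPairing_sub hp1 hp
      (mult u (herzPairing μ p (ccToLp μ _ x₀.1) (ccToLp μ _ x₀.2)))
    refine squeeze_zero_norm (fun x => norm_le_of_toFun_eq hp1 hp fun y => ?_)
      (tendsto_zero_iff_norm_tendsto_zero.1 h)
    rw [map_sub, map_smul, Pi.sub_apply, Pi.smul_apply, toFun_mult, toFun_mult, toFun_mult,
      ← toBCF_ofPairing hp1 hp x₀, ← toBCF_ofPairing hp1 hp x₀, ofPairing_apply_one hp1 hp hx₀,
      ← toBCF_ofPairing hp1 hp x, mul_one, map_sub, map_smul, map_mul, map_mul,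
      BoundedContinuousFunction.sub_apply, BoundedContinuousFunction.smul_apply,
      BoundedContinuousFunction.mul_apply, BoundedContinuousFunction.mul_apply, smul_eq_mul]
    ring
  -- `(u w₀ w - u(e) w) - u (w₀ w - w) = u w - u(e) w`.
  have h := (key u).sub ((key 1).const_mul u)
  rw [mul_zero, sub_zero] at h
  refine h.congr fun x => ?_
  have h1 : toBCF (1 : Bp μ p) 1 = 1 := rfl
  rw [h1, one_smul, one_mul]
  ring

end Bp

/-! ### Existence and uniqueness of the invariant mean. -/

/-- There is a topological invariant mean on `wap(B_p(G))`, a limit `F(T) = lim T(w)` along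
normalized functions `w` whose supports shrink to the identity. -/
theorem exists_topInvariant_mean [μ.Regular] (hp1 : 1 < p) (hp : p ≠ ∞) :
    ∃ F : StrongDual ℂ (Wap μ p), IsMean F ∧ IsTopInvariant F := by
  have := bumpFilter_neBot (G := G) (μ := μ) hp1 hp
  let U := Ultrafilter.of (bumpFilter μ p : Filter (C_c(G, ℂ) × C_c(G, ℂ)))
  have hU : (U : Filter _) ≤ bumpFilter μ p := Ultrafilter.of_le _
  let J : C_c(G, ℂ) × C_c(G, ℂ) → StrongDual ℂ (Wap μ p) := fun x =>
    (NormedSpace.inclusionInDoubleDual ℂ (Bp μ p) (Bp.ofPairing μ hp1 hp x)).comp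
      Wap.incl.toContinuousLinearMap
  have hJ : ∀ x T, J x T = Wap.incl T (Bp.ofPairing μ hp1 hp x) := fun _ _ => rfl
  have hJn : ∀ᶠ x in U, ‖J x‖ ≤ 1 := by
    filter_upwards [hU (Bp.eventually_norm_ofPairing_le_one hp1 hp)] with x hx
    refine ContinuousLinearMap.opNorm_le_bound _ zero_le_one fun T => ?_
    rw [hJ, one_mul]
    refine ((Wap.incl T).le_opNorm _).trans ?_
    rw [Wap.incl.norm_map]
    exact mul_le_of_le_one_right (norm_nonneg _) hx
  obtain ⟨Φ, hΦ, hlim⟩ := (WeakDual.isCompact_closedBall (𝕜 := ℂ)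
    (0 : StrongDual ℂ (Wap μ p)) 1).ultrafilter_le_nhds
      (U.map fun x => StrongDual.toWeakDual (J x)) (tendsto_principal.2 <| by
        filter_upwards [hJn] with x hx
        simpa using hx)
  let F : StrongDual ℂ (Wap μ p) := WeakDual.toStrongDual Φ
  have hF : ∀ T, Tendsto (fun x => Wap.incl T (Bp.ofPairing μ hp1 hp x)) U (𝓝 (F T)) := fun T =>
    ((WeakDual.eval_continuous T).tendsto Φ).comp hlim
  have hFn : ‖F‖ ≤ 1 := by simpa using hΦ
  have hFI : F Wap.I = 1 := by
    refine tendsto_nhds_unique (hF Wap.I) (tendsto_const_nhds.congr' ?_)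
    filter_upwards [hU (Bp.eventually_ofPairing_apply_one hp1 hp)] with x hx
    rw [Wap.incl_I, evalOne_apply, hx]
  have hI : ‖(Wap.I : Wap μ p)‖ ≤ 1 := by
    rw [← Wap.incl.norm_map, Wap.incl_I]
    exact LinearMap.mkContinuous_norm_le _ zero_le_one _
  refine ⟨F, ⟨le_antisymm hFn ?_, hFI⟩, fun u T => ?_⟩
  · have := F.le_opNorm Wap.I
    rw [hFI, norm_one] at this
    exact this.trans (mul_le_of_le_one_right (norm_nonneg _) hI)
  -- `T(u w) = T(u w - u(e) w) + u(e) T(w)`, and the first term tends to `0`.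
  · have h1 := (((Wap.incl T).continuous.tendsto 0).comp
      (Bp.tendsto_mul_ofPairing_sub hp1 hp u)).mono_left hU
    have h2 := h1.add ((hF T).const_mul (Bp.toBCF u 1))
    rw [map_zero, zero_add] at h2
    refine tendsto_nhds_unique (hF _) (h2.congr fun x => ?_)
    simp only [Function.comp_apply, map_sub, map_smul, smul_eq_mul, sub_add_cancel]
    rfl

/-- A normalized invariant functional on `wap(B_p(G))` is the limit `F(T) = lim T(w)` along
shrinking normalized functions `w`. -/
theorem tendsto_of_topInvariant [μ.Regular] (hp1 : 1 < p) (hp : p ≠ ∞)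
    {F : StrongDual ℂ (Wap μ p)} (hFI : F Wap.I = 1) (hF : IsTopInvariant F) (T : Wap μ p)
    {U : Ultrafilter (C_c(G, ℂ) × C_c(G, ℂ))} (hU : (U : Filter _) ≤ bumpFilter μ p) :
    Tendsto (fun x => Wap.incl T (Bp.ofPairing μ hp1 hp x)) U (𝓝 (F T)) := by
  -- Weak convergence in `B_p(G)^*` is tested by functionals on the whole dual, so `F` is extended
  -- from `wap(B_p(G))` by Hahn-Banach.
  obtain ⟨F', hF', -⟩ : ∃ F' : StrongDual ℂ (StrongDual ℂ (Bp μ p)),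
      (∀ S : Wap μ p, F' (Wap.incl S) = F S) ∧ _ := exists_extension_norm_eq (wapSubmodule μ p) F
  have hT : IsWAP (Wap.incl T) := T.2
  -- Weak almost periodicity enters here: the limit `R` of `w T` is weak, not merely weak-*, so it
  -- may be tested against `F'`.
  obtain ⟨R, -, hR⟩ := IsCompact.ultrafilter_le_nhds hT
    (U.map fun x => toWeakSpace ℂ _ (act (Bp.ofPairing μ hp1 hp x) (Wap.incl T))) (tendsto_principal.2 <| by
      filter_upwards [hU (Bp.eventually_norm_ofPairing_le_one hp1 hp)] with x hx
      exact mem_weakOrbit_closure _ hx)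
  obtain ⟨R, rfl⟩ := (toWeakSpace ℂ (StrongDual ℂ (Bp μ p))).surjective R
  have hlim : ∀ φ : StrongDual ℂ (StrongDual ℂ (Bp μ p)),
      Tendsto (fun x => φ (act (Bp.ofPairing μ hp1 hp x) (Wap.incl T))) U (𝓝 (φ R)) := fun φ =>
    ((WeakBilin.eval_continuous (topDualPairing ℂ (StrongDual ℂ (Bp μ p))).flip φ).tendsto _).comp
      hR
  have hRv : ∀ v, Tendsto (fun x => Wap.incl T (v * Bp.ofPairing μ hp1 hp x)) U (𝓝 (R v)) :=
    fun v => (hlim (NormedSpace.inclusionInDoubleDual ℂ (Bp μ p) v)).congr fun x => by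
      rw [NormedSpace.dual_def, act_apply, mul_comm]
  have hR1 : Tendsto (fun x => Wap.incl T (Bp.ofPairing μ hp1 hp x)) U (𝓝 (R 1)) := by
    simpa only [one_mul] using hRv 1
  have hRI : R = R 1 • evalOne μ p := by
    ext v
    have h1 := (((Wap.incl T).continuous.tendsto 0).comp
      (Bp.tendsto_mul_ofPairing_sub hp1 hp v)).mono_left hU
    have h2 := h1.add (hR1.const_mul (Bp.toBCF v 1))
    rw [map_zero, zero_add] at h2
    rw [smul_apply, evalOne_apply, smul_eq_mul, mul_comm]
    refine tendsto_nhds_unique (hRv v) (h2.congr fun x => ?_)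
    simp only [Function.comp_apply, map_sub, map_smul, smul_eq_mul, sub_add_cancel]
  have hFR : F' R = F T := by
    refine tendsto_nhds_unique (hlim F') (tendsto_const_nhds.congr' ?_)
    -- By invariance `F'(w T) = w(e) F(T) = F(T)`, so the sequence of values is eventually constant.
    filter_upwards [hU (Bp.eventually_ofPairing_apply_one hp1 hp)] with x hx
    rw [← Wap.incl_smulB, hF', hF, hx, one_mul]
  rw [hRI, map_smul, ← Wap.incl_I, hF', hFI, smul_eq_mul, mul_one] at hFR
  rwa [← hFR]

theorem topInvariant_unique [μ.Regular] (hp1 : 1 < p) (hp : p ≠ ∞)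
    {F F' : StrongDual ℂ (Wap μ p)} (hFI : F Wap.I = 1) (hF : IsTopInvariant F)
    (hFI' : F' Wap.I = 1) (hF' : IsTopInvariant F') : F = F' := by
  have := bumpFilter_neBot (G := G) (μ := μ) hp1 hp
  ext T
  exact tendsto_nhds_unique
    (tendsto_of_topInvariant hp1 hp hFI hF T (Ultrafilter.of_le (bumpFilter μ p)))
    (tendsto_of_topInvariant hp1 hp hFI' hF' T (Ultrafilter.of_le (bumpFilter μ p)))

end Bumps

end Herz

end

theorem proposition3p7 {G : Type*} [Group G] [TopologicalSpace G] [IsTopologicalGroup G]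
    [LocallyCompactSpace G] [T2Space G] [MeasurableSpace G] [BorelSpace G]
    (μ : Measure G) [μ.IsHaarMeasure] [μ.Regular]
    (p : ℝ≥0∞) [Fact (1 ≤ p)] (hp_one : 1 < p) (hp_top : p < ∞) :
    (∃! F : StrongDual ℂ (Herz.Wap μ p), Herz.IsMean F ∧ Herz.IsTopInvariant F) ∧
    (∃! F : StrongDual ℂ (Herz.Wap μ p), F Herz.Wap.I = 1 ∧
      ∀ (u : Herz.Bp μ p) (T : Herz.Wap μ p),
        F (Herz.Wap.smulB u T) = Herz.Bp.toBCF u 1 * F T) := by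
  obtain ⟨F, hF, hinv⟩ := Herz.exists_topInvariant_mean (μ := μ) hp_one hp_top.ne
  -- Uniqueness needs only `F(I) = 1` and invariance, so the same mean serves both assertions.
  exact ⟨⟨F, ⟨hF, hinv⟩, fun F' hF' =>
      Herz.topInvariant_unique hp_one hp_top.ne hF'.1.2 hF'.2 hF.2 hinv⟩,
    ⟨F, ⟨hF.2, hinv⟩, fun F' hF' =>
      Herz.topInvariant_unique hp_one hp_top.ne hF'.1 hF'.2 hF.2 hinv⟩⟩
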